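/- Let $\mathcal H$ be a complex separable Hilbert space, $L(\mathcal H)$ its bounded operators, and $J\in L(\mathcal H)$ a symmetry, i.e. $J=J^*=J^{-1}$. For $T\in L(\mathcal H)$ put $T^{\#}=JT^*J$. Let $$\mathcal U_J=\{U\in L(\mathcal H): UU^{\#}=U^{\#}U=I\},\qquad \mathfrak u_J=\{X\in L(\mathcal H): X^{\#}=-X\},\qquad \mathcal Q=\{Q\in L(\mathcal H): Q^2=Q,\ QQ^{\#}=Q^{\#}Q\},$$ and let $\mathcal U_J$ act on $\mathcal Q$ by $U\cdot Q=UQU^{\#}$. Give $\mathcal U_J$ the norm topology; it is a real Banach–Lie group, namely a real-analytic Banach–Lie subgroup of the group $GL(\mathcal H)$ of invertible operators, with Lie algebra $\mathfrak u_J$. (A Banach–Lie subgroup $K$ of $G$ is a subgroup which, with the subspace topology, is itself a real-analytic Banach–Lie group such that the inclusion $K\to G$ is a real-analytic embedding with complemented tangent spaces; its Lie algebra is viewed inside that of $G$ through the differential of the inclusion.) Let $Q_0\in\mathcal Q$. Then: 1. The isotropy group $\mathcal G=\{U\in\mathcal U_J: U\cdot Q_0=Q_0\}$ is a Banach–Lie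 subgroup of $\mathcal U_J$; its Lie algebra is $\mathfrak g=\{X\in\mathfrak u_J: XQ_0=Q_0X\}$, and $\mathfrak g$ is a closed complemented real subspace of $\mathfrak u_J$. 2. The orbit $\mathcal U_J\cdot Q_0$ is a real-analytic homogeneous space of $\mathcal U_J$: with the quotient topology induced by $p_{Q_0}:\mathcal U_J\to\mathcal U_J\cdot Q_0$, $p_{Q_0}(U)=UQ_0U^{\#}$, it carries the structure of a Hausdorff real-analytic Banach manifold such that the (transitive) action $\mathcal U_J\times(\mathcal U_J\cdot Q_0)\to\mathcal U_J\cdot Q_0$ is real analytic and, for every $Q\in\mathcal U_J\cdot Q_0$, the orbit map $U\mapsto U\cdot Q$ (in particular $p_{Q_0}$) is a real-analytic submersion with complemented kernels. -/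

import Mathlib

open scoped Manifold ContDiff

noncomputable section

namespace KreinHomogeneous

/-! ### Banach–Lie subgroups and homogeneous spaces -/

section LieTheory

variable (E : Type*) [NormedAddCommGroup E] [NormedSpace ℝ E]
  {G : Type*} [TopologicalSpace G] [ChartedSpace E G] [Group G]

/-- A subgroup `K` of a real Banach–Lie group `G` modelled on `E`, with the subspace topology and with a given
atlas modelled on the Banach space `F`, is a (real-analytic) Banach–Lie subgroup: it is itself a
real-analytic Lie group, and the inclusion `K → G` is a real-analytic embedding, that is, a
homeomorphism onto its image which in suitable analytic charts is the inclusion of a closed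
complemented subspace. -/
structure IsBanachLieSubgroup (K : Subgroup G) (F : Type*) [NormedAddCommGroup F] [NormedSpace ℝ F]
    [ChartedSpace F K] : Prop where
  completeSpace : CompleteSpace F
  lieGroup : LieGroup 𝓘(ℝ, F) ω K
  isSmoothEmbedding :
    Manifold.IsSmoothEmbedding 𝓘(ℝ, F) 𝓘(ℝ, E) ω (Subtype.val : K → G)

/-- The Lie algebra of a Banach–Lie subgroup `K` of `G`, as a subspace of the Lie algebra
`T₁ G` of `G`: the image of `T₁ K` under the differential of the inclusion. -/
def subgroupLieAlgebra (K : Subgroup G) (F : Type*) [NormedAddCommGroup F] [NormedSpace ℝ F]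
    [ChartedSpace F K] : Submodule ℝ (GroupLieAlgebra 𝓘(ℝ, E) G) :=
  (mfderiv 𝓘(ℝ, F) 𝓘(ℝ, E) (Subtype.val : K → G) 1).range

/-- `M`, with a given atlas modelled on the Banach space `B`, is a real-analytic homogeneous space
of the real Banach–Lie group `G` (modelled on `E`): it is a Hausdorff real-analytic Banach manifold on which `G` acts
analytically and transitively, and every orbit map `g ↦ g • x` is a real-analytic submersion
(in suitable analytic charts it is the projection onto a complemented subspace). -/
structure IsAnalyticHomogeneousSpace (G : Type*) [TopologicalSpace G] [ChartedSpace E G] [Group G]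
    (B : Type*) [NormedAddCommGroup B] [NormedSpace ℝ B]
    (M : Type*) [TopologicalSpace M] [ChartedSpace B M] [MulAction G M] : Prop where
  completeSpace : CompleteSpace B
  t2Space : T2Space M
  isManifold : IsManifold 𝓘(ℝ, B) ω M
  contMDiffSMul : ContMDiffSMul 𝓘(ℝ, E) 𝓘(ℝ, B) ω G M
  nonempty : Nonempty M
  isPretransitive : MulAction.IsPretransitive G M
  isSubmersion : ∀ x : M, Manifold.IsSubmersion 𝓘(ℝ, E) 𝓘(ℝ, B) ω (fun g : G => g • x)

end LieTheory

/-! ### Krein spaces -/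

variable {H : Type*} [NormedAddCommGroup H] [InnerProductSpace ℂ H] [CompleteSpace H]

/-- A symmetry on `H`: a bounded operator `J` with `J = J* = J⁻¹`. -/
structure FundamentalSymmetry (H : Type*) [NormedAddCommGroup H] [InnerProductSpace ℂ H]
    [CompleteSpace H] where
  op : H →L[ℂ] H
  adjoint_op : ContinuousLinearMap.adjoint op = op
  op_mul_op : op * op = 1

/-- The `J`-adjoint `T^# = J T* J`. -/
def jAdjoint (J : FundamentalSymmetry H) (T : H →L[ℂ] H) : H →L[ℂ] H :=
  J.op * ContinuousLinearMap.adjoint T * J.op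

theorem adjoint_mul (S T : H →L[ℂ] H) : ContinuousLinearMap.adjoint (S * T) =
    ContinuousLinearMap.adjoint T * ContinuousLinearMap.adjoint S :=
  ContinuousLinearMap.adjoint_comp S T

theorem jAdjoint_mul (J : FundamentalSymmetry H) (S T : H →L[ℂ] H) :
    jAdjoint J (S * T) = jAdjoint J T * jAdjoint J S := by
  unfold jAdjoint
  rw [adjoint_mul]
  calc J.op * (ContinuousLinearMap.adjoint T * ContinuousLinearMap.adjoint S) * J.op
      = J.op * ContinuousLinearMap.adjoint T * 1 * ContinuousLinearMap.adjoint S * J.op := by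
        simp only [mul_assoc, one_mul]
    _ = _ := by rw [← J.op_mul_op]; simp only [mul_assoc]

theorem jAdjoint_one (J : FundamentalSymmetry H) : jAdjoint J 1 = 1 := by
  unfold jAdjoint
  rw [show ContinuousLinearMap.adjoint (1 : H →L[ℂ] H) = 1 from star_one _, mul_one, J.op_mul_op]

theorem jAdjoint_jAdjoint (J : FundamentalSymmetry H) (T : H →L[ℂ] H) :
    jAdjoint J (jAdjoint J T) = T := by
  unfold jAdjoint
  rw [adjoint_mul, adjoint_mul, J.adjoint_op, ContinuousLinearMap.adjoint_adjoint]
  calc J.op * (J.op * (T * J.op)) * J.op = (J.op * J.op) * T * (J.op * J.op) := by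
        simp only [mul_assoc]
    _ = T := by rw [J.op_mul_op, one_mul, mul_one]

/-- The group `𝒰_J` of bounded `J`-unitary operators, `U U^# = U^# U = 1`, as a subgroup of the
group of invertible bounded operators. -/
def jUnitary (J : FundamentalSymmetry H) : Subgroup (H →L[ℂ] H)ˣ where
  carrier := {U | (U : H →L[ℂ] H) * jAdjoint J U = 1 ∧ jAdjoint J U * (U : H →L[ℂ] H) = 1}
  one_mem' := by simp [jAdjoint_one]
  mul_mem' := by
    rintro U V ⟨hU, hU'⟩ ⟨hV, hV'⟩
    constructor
    · rw [Units.val_mul, jAdjoint_mul]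
      calc (U : H →L[ℂ] H) * V * (jAdjoint J V * jAdjoint J U)
          = U * (V * jAdjoint J V) * jAdjoint J U := by simp only [mul_assoc]
        _ = 1 := by rw [hV, mul_one, hU]
    · rw [Units.val_mul, jAdjoint_mul]
      calc jAdjoint J V * jAdjoint J U * ((U : H →L[ℂ] H) * V)
          = jAdjoint J V * (jAdjoint J U * U) * V := by simp only [mul_assoc]
        _ = 1 := by rw [hU', mul_one, hV']
  inv_mem' := by
    rintro U ⟨hU, hU'⟩
    have h : ((U⁻¹ : (H →L[ℂ] H)ˣ) : H →L[ℂ] H) = jAdjoint J U := Units.inv_eq_of_mul_eq_one_right hU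
    constructor
    · rw [h, jAdjoint_jAdjoint, hU']
    · rw [h, jAdjoint_jAdjoint, hU]

theorem jAdjoint_add (J : FundamentalSymmetry H) (S T : H →L[ℂ] H) :
    jAdjoint J (S + T) = jAdjoint J S + jAdjoint J T := by
  simp [jAdjoint, mul_add, add_mul]

theorem jAdjoint_real_smul (J : FundamentalSymmetry H) (c : ℝ) (T : H →L[ℂ] H) :
    jAdjoint J (c • T) = c • jAdjoint J T := by
  have h : ContinuousLinearMap.adjoint (c • T) = c • ContinuousLinearMap.adjoint T := by
    change star (c • T) = c • star T
    rw [star_smul, star_trivial]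
  simp [jAdjoint, h]

/-- The real Banach space `𝔲_J` of `J`-antihermitian operators, `X^# = -X`. -/
def jAntihermitian (J : FundamentalSymmetry H) : Submodule ℝ (H →L[ℂ] H) where
  carrier := {X | jAdjoint J X = -X}
  zero_mem' := by simp [jAdjoint]
  add_mem' := by
    intro X Y hX hY
    simp only [Set.mem_ofPred_eq] at hX hY ⊢
    rw [jAdjoint_add, hX, hY, neg_add]
  smul_mem' := by
    intro c X hX
    simp only [Set.mem_ofPred_eq] at hX ⊢
    rw [jAdjoint_real_smul, hX, smul_neg]

/-- The set `𝒬` of `J`-normal projections: `Q² = Q` and `Q Q^# = Q^# Q`. -/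
def jNormalProjections (J : FundamentalSymmetry H) : Set (H →L[ℂ] H) :=
  {Q | Q * Q = Q ∧ Q * jAdjoint J Q = jAdjoint J Q * Q}

theorem conj_mem (J : FundamentalSymmetry H) {U : (H →L[ℂ] H)ˣ} (hU : U ∈ jUnitary J)
    {Q : H →L[ℂ] H} (hQ : Q ∈ jNormalProjections J) :
    (U : H →L[ℂ] H) * Q * jAdjoint J U ∈ jNormalProjections J := by
  obtain ⟨-, h⟩ := hU
  obtain ⟨hQ1, hQ2⟩ := hQ
  have key : ∀ A B : H →L[ℂ] H, (U : H →L[ℂ] H) * A * jAdjoint J U * (U * B * jAdjoint J U)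
      = U * (A * B) * jAdjoint J U := by
    intro A B
    calc (U : H →L[ℂ] H) * A * jAdjoint J U * (U * B * jAdjoint J U)
        = U * A * (jAdjoint J U * U) * B * jAdjoint J U := by simp only [mul_assoc]
      _ = _ := by rw [h]; simp only [mul_assoc, one_mul]
  have hadj : jAdjoint J ((U : H →L[ℂ] H) * Q * jAdjoint J U) =
      U * jAdjoint J Q * jAdjoint J U := by
    rw [jAdjoint_mul, jAdjoint_mul, jAdjoint_jAdjoint, mul_assoc]
  refine ⟨?_, ?_⟩
  · rw [key, hQ1]
  · rw [hadj, key, key, hQ2]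

/-- The action `U · Q = U Q U^#` of `𝒰_J` on `𝒬`. -/
instance (J : FundamentalSymmetry H) : MulAction (jUnitary J) (jNormalProjections J) where
  smul U Q := ⟨(U : (H →L[ℂ] H)ˣ) * (Q : H →L[ℂ] H) * jAdjoint J (U : (H →L[ℂ] H)ˣ),
    conj_mem J U.2 Q.2⟩
  one_smul Q := by
    apply Subtype.ext
    change ((1 : (H →L[ℂ] H)ˣ) : H →L[ℂ] H) * (Q : H →L[ℂ] H) *
      jAdjoint J ((1 : (H →L[ℂ] H)ˣ) : H →L[ℂ] H) = Q
    rw [Units.val_one, jAdjoint_one, one_mul, mul_one]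
  mul_smul U V Q := by
    apply Subtype.ext
    change (((U : (H →L[ℂ] H)ˣ) * (V : (H →L[ℂ] H)ˣ) : (H →L[ℂ] H)ˣ) : H →L[ℂ] H) *
      (Q : H →L[ℂ] H) * jAdjoint J (((U : (H →L[ℂ] H)ˣ) * (V : (H →L[ℂ] H)ˣ) : (H →L[ℂ] H)ˣ) :
        H →L[ℂ] H) = (U : (H →L[ℂ] H)ˣ) * ((V : (H →L[ℂ] H)ˣ) * (Q : H →L[ℂ] H) *
      jAdjoint J (V : (H →L[ℂ] H)ˣ)) * jAdjoint J (U : (H →L[ℂ] H)ˣ)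
    rw [Units.val_mul, jAdjoint_mul]
    simp only [mul_assoc]

/-- The isotropy group of `Q₀` in `𝒰_J`. -/
abbrev isotropy (J : FundamentalSymmetry H) (Q₀ : jNormalProjections J) : Subgroup (jUnitary J) :=
  MulAction.stabilizer (jUnitary J) Q₀

/-- The real subspace `𝔤 = {X ∈ 𝔲_J : X Q₀ = Q₀ X}`. -/
def isotropyAntihermitian (J : FundamentalSymmetry H) (Q₀ : jNormalProjections J) :
    Submodule ℝ (H →L[ℂ] H) where
  carrier := {X | X ∈ jAntihermitian J ∧ X * (Q₀ : H →L[ℂ] H) = (Q₀ : H →L[ℂ] H) * X}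
  zero_mem' := by simp
  add_mem' := by
    rintro X Y ⟨hX, hX'⟩ ⟨hY, hY'⟩
    exact ⟨add_mem hX hY, by rw [add_mul, mul_add, hX', hY']⟩
  smul_mem' := by
    rintro c X ⟨hX, hX'⟩
    exact ⟨Submodule.smul_mem _ c hX, by rw [smul_mul_assoc, mul_smul_comm, hX']⟩

/-- The orbit `𝒰_J · Q₀` with the quotient topology coming from `𝒰_J` (it is not declared with the
subspace topology of the bounded operators). -/
def OrbitSpace (J : FundamentalSymmetry H) (Q₀ : jNormalProjections J) : Type _ :=
  MulAction.orbit (jUnitary J) Q₀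

/-- The map `p_{Q₀} : 𝒰_J → 𝒰_J · Q₀`, `U ↦ U Q₀ U^#`. -/
def orbitMap (J : FundamentalSymmetry H) (Q₀ : jNormalProjections J) (U : jUnitary J) :
    OrbitSpace J Q₀ :=
  ⟨U • Q₀, MulAction.mem_orbit Q₀ U⟩

instance (J : FundamentalSymmetry H) (Q₀ : jNormalProjections J) :
    TopologicalSpace (OrbitSpace J Q₀) :=
  TopologicalSpace.coinduced (orbitMap J Q₀) inferInstance

instance (J : FundamentalSymmetry H) (Q₀ : jNormalProjections J) :
    MulAction (jUnitary J) (OrbitSpace J Q₀) :=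
  inferInstanceAs (MulAction (jUnitary J) (MulAction.orbit (jUnitary J) Q₀))

end KreinHomogeneous

end

open KreinHomogeneous

universe u

open scoped Topology

noncomputable section

namespace KreinHomogeneous

/-! ### Manifold structures by translation of one chart -/

section Translate

variable {G : Type*} [Group G] {M : Type*} [TopologicalSpace M] [MulAction G M]
  [ContinuousConstSMul G M] {X : Type*} [TopologicalSpace X]

/-! Everything rests on one chart of `GL(H)` at the identity, the Cayley transform `c(U) = 2 (U - 1)
(U + 1)⁻¹`, an analytic chart with `c(1) = 0` whose inverse has derivative the identity at `0`. In
it both groups become linear at once: `U` is `J`-unitary iff `c(U)` is `J`-antihermitian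
(`mem_jUnitary_iff_cayley`), and `U` commutes with `Q₀` iff `c(U)` does (`commute_cayley_iff`). For
`J`-unitary `U`, fixing `Q₀` is the same as commuting with it.

The linear subspaces split. On `𝔲_J` the projection is `X ↦ (X - X^#) / 2`. On `𝔤`, write `C_Q X = Q
X Q + (1 - Q) X (1 - Q)`, which projects onto the commutant of `Q`. Since `(C_Q X)^# = C_{Q^#} X^#`,
the map `C_{Q₀}` alone need not preserve `𝔲_J`. Normality of `Q₀` makes `C_{Q₀}` and `C_{Q₀^#}`
commute, so their product does preserve `𝔲_J`. It takes values in `𝔤`, and fixes `𝔤` because a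
`J`-antihermitian operator commuting with `Q₀` also commutes with `Q₀^#`.

A chart that flattens a subgroup onto a complemented subspace (`IsSliceChart`) yields, by left
translation, a Banach–Lie subgroup. This is applied to `𝒰_J` in `GL(H)`, then to the isotropy group
in `𝒰_J`, with the restricted Cayley chart.

For the orbit, let `P` be the projection onto the model of the stabilizer `K` in a slice chart `e`.
The map `x ↦ e(e⁻¹(x - P x) e⁻¹(P x))` has derivative the identity at `0`, so the inverse function
theorem turns it into a chart whose fibres over `x - P x` are pieces of cosets of `K`
(`exists_isAdaptedChart`). Hence `ker P` models the orbit near the base point, and translation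
carries this chart everywhere. The orbit is Hausdorff because it injects continuously into the
bounded operators. -/

/-- The translate `m ↦ κ (g⁻¹ • m)` of a chart `κ`. -/
def translate (κ : OpenPartialHomeomorph M X) (g : G) : OpenPartialHomeomorph M X :=
  (Homeomorph.smul g⁻¹).transOpenPartialHomeomorph κ

theorem translate_apply (κ : OpenPartialHomeomorph M X) (g : G) (m : M) :
    translate κ g m = κ (g⁻¹ • m) := rfl

theorem translate_symm_apply (κ : OpenPartialHomeomorph M X) (g : G) (x : X) :
    (translate κ g).symm x = g • κ.symm x := by
  change (g⁻¹)⁻¹ • κ.symm x = g • κ.symm x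
  rw [inv_inv]

theorem mem_translate_source {κ : OpenPartialHomeomorph M X} {g : G} {m : M} :
    m ∈ (translate κ g).source ↔ g⁻¹ • m ∈ κ.source := Iff.rfl

theorem translate_target (κ : OpenPartialHomeomorph M X) (g : G) :
    (translate κ g).target = κ.target := rfl

theorem translate_one (κ : OpenPartialHomeomorph M X) : translate κ (1 : G) = κ := by
  ext x
  · simp [translate_apply]
  · simp [translate_symm_apply]
  · simp [mem_translate_source]

variable (G) in
/-- The charted space structure given by the translates of a chart at a point of a
transitive action. -/
@[reducible]
def translatedChartedSpace [MulAction.IsPretransitive G M] (κ : OpenPartialHomeomorph M X)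
    (m₀ : M) (hm₀ : m₀ ∈ κ.source) : ChartedSpace X M where
  atlas := Set.range (translate κ : G → OpenPartialHomeomorph M X)
  chartAt m := translate κ (MulAction.exists_smul_eq G m₀ m).choose
  mem_chart_source m := by
    have h := (MulAction.exists_smul_eq G m₀ m).choose_spec
    rw [mem_translate_source, inv_smul_eq_iff.2 h.symm]
    exact hm₀
  chart_mem_atlas m := ⟨_, rfl⟩

/-- The transition from the translate by `g` to the translate by `g'` depends only on `g'⁻¹ * g`, so
it suffices that each group element acts analytically when read in the single chart `κ`. -/
theorem isManifold_translatedChartedSpace {B : Type*} [NormedAddCommGroup B] [NormedSpace ℝ B]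
    [MulAction.IsPretransitive G M]
    (κ : OpenPartialHomeomorph M B) (m₀ : M) (hm₀ : m₀ ∈ κ.source)
    (h : ∀ g : G, ContDiffOn ℝ ω (fun v => κ (g • κ.symm v))
      {v | v ∈ κ.target ∧ g • κ.symm v ∈ κ.source}) :
    letI := translatedChartedSpace G κ m₀ hm₀
    IsManifold 𝓘(ℝ, B) ω M := by
  let := translatedChartedSpace G κ m₀ hm₀
  apply isManifold_of_contDiffOn
  rintro _ _ ⟨g, rfl⟩ ⟨g', rfl⟩
  refine ((h (g'⁻¹ * g)).congr ?_).mono ?_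
  · intro v hv
    simp [translate_apply, translate_symm_apply, mul_smul]
  · intro v hv
    simpa [mem_translate_source, translate_symm_apply, mul_smul, translate_target] using! hv

end Translate

/-! ### Subgroups given by a slice chart -/

section Slice

variable {E : Type*} [NormedAddCommGroup E] [NormedSpace ℝ E]
  {G : Type*} [TopologicalSpace G] [ChartedSpace E G] [Group G]
  {F : Type*} [NormedAddCommGroup F] [NormedSpace ℝ F]

/-- An analytic chart `e` of `G` centred at `1`, in which the subgroup `K` becomes the range of
the linear embedding `ι : F → E` with retraction `r`. -/
structure IsSliceChart (K : Subgroup G) (ι : F →L[ℝ] E) (r : E →L[ℝ] F)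
    (e : OpenPartialHomeomorph G E) : Prop where
  retract : ∀ x, r (ι x) = x
  mem_maximalAtlas : e ∈ IsManifold.maximalAtlas 𝓘(ℝ, E) ω G
  one_mem : (1 : G) ∈ e.source
  map_one : e 1 = 0
  mem_iff : ∀ g ∈ e.source, g ∈ K ↔ ι (r (e g)) = e g

theorem translate_mem_maximalAtlas [ContinuousConstSMul G G] [LieGroup 𝓘(ℝ, E) ω G]
    {e : OpenPartialHomeomorph G E}
    (he : e ∈ IsManifold.maximalAtlas 𝓘(ℝ, E) ω G) (g : G) :
    translate e g ∈ IsManifold.maximalAtlas 𝓘(ℝ, E) ω G := by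
  rw [IsManifold.mem_maximalAtlas_iff_contMDiffOn] at he ⊢
  refine ⟨?_, ?_⟩
  · exact he.1.comp (contMDiff_mul_left (a := g⁻¹)).contMDiffOn fun x hx => hx
  · have : ((translate e g).symm : E → G) = (fun x => g * x) ∘ e.symm := by
      ext x; simp [translate_symm_apply]
    rw [this, translate_target]
    exact (contMDiff_mul_left (a := g)).comp_contMDiffOn he.2

namespace IsSliceChart

variable {K : Subgroup G} {ι : F →L[ℝ] E} {r : E →L[ℝ] F} {e : OpenPartialHomeomorph G E}

theorem zero_mem_target (h : IsSliceChart K ι r e) : (0 : E) ∈ e.target :=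
  h.map_one ▸ e.map_source h.one_mem

theorem symm_zero (h : IsSliceChart K ι r e) : e.symm 0 = 1 := by
  rw [← h.map_one, e.left_inv h.one_mem]

theorem symm_mem (h : IsSliceChart K ι r e) {x : F} (hx : ι x ∈ e.target) :
    e.symm (ι x) ∈ K := by
  rw [h.mem_iff _ (e.map_target hx), e.right_inv hx, h.retract]

open Classical in
/-- The chart of the subgroup induced by a slice chart. -/
def restrict (h : IsSliceChart K ι r e) : OpenPartialHomeomorph K F where
  toFun k := r (e k)
  -- The value `1` is a mere filler: on the target, `e.symm (ι x)` lies in `K` by `symm_mem`.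
  invFun x := if hx : e.symm (ι x) ∈ K then ⟨e.symm (ι x), hx⟩ else 1
  source := Subtype.val ⁻¹' e.source
  target := ι ⁻¹' e.target
  map_source' k hk := by
    change ι (r (e k)) ∈ e.target
    rw [(h.mem_iff _ hk).1 k.2]
    exact e.map_source hk
  map_target' x hx := by
    rw [dif_pos (h.symm_mem hx)]
    exact e.map_target hx
  left_inv' k hk := by
    have : e.symm (ι (r (e k))) = k := by rw [(h.mem_iff _ hk).1 k.2, e.left_inv hk]
    apply Subtype.ext
    rw [dif_pos (by rw [this]; exact k.2)]
    exact this
  right_inv' x hx := by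
    rw [dif_pos (h.symm_mem hx)]
    change r (e (e.symm (ι x))) = x
    rw [e.right_inv hx, h.retract]
  open_source := e.open_source.preimage continuous_subtype_val
  open_target := e.open_target.preimage ι.continuous
  continuousOn_toFun := r.continuous.comp_continuousOn
    (e.continuousOn.comp continuous_subtype_val.continuousOn fun _ hk => hk)
  continuousOn_invFun := by
    rw [Topology.IsInducing.subtypeVal.continuousOn_iff]
    refine (e.continuousOn_symm.comp ι.continuous.continuousOn fun _ hx => hx).congr ?_
    intro x hx
    simp only [Function.comp]
    rw [dif_pos (h.symm_mem hx)]

theorem restrict_apply (h : IsSliceChart K ι r e) (k : K) : h.restrict k = r (e k) := rfl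

theorem restrict_symm_coe (h : IsSliceChart K ι r e) {x : F} (hx : ι x ∈ e.target) :
    (h.restrict.symm x : G) = e.symm (ι x) := by
  classical
  change ((if hx : e.symm (ι x) ∈ K then (⟨e.symm (ι x), hx⟩ : K) else 1 : K) : G) = _
  rw [dif_pos (h.symm_mem hx)]

theorem one_mem_restrict (h : IsSliceChart K ι r e) : (1 : K) ∈ h.restrict.source := h.one_mem

theorem restrict_one (h : IsSliceChart K ι r e) : h.restrict 1 = 0 := by
  rw [restrict_apply, OneMemClass.coe_one, h.map_one, _root_.map_zero]

variable [IsTopologicalGroup G]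

/-- The charted space structure on the subgroup given by the translates of a slice chart. -/
@[reducible]
def chartedSpace (h : IsSliceChart K ι r e) : ChartedSpace F K :=
  translatedChartedSpace K h.restrict 1 h.one_mem_restrict

theorem translate_restrict_mem_atlas (h : IsSliceChart K ι r e) (k : K) :
    letI := h.chartedSpace
    translate h.restrict k ∈ atlas F K := ⟨k, rfl⟩

theorem chartAt_one (h : IsSliceChart K ι r e) :
    letI := h.chartedSpace
    chartAt F (1 : K) = h.restrict := by
  let := h.chartedSpace
  change translate h.restrict (MulAction.exists_smul_eq K (1 : K) (1 : K)).choose = _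
  have := (MulAction.exists_smul_eq K (1 : K) (1 : K)).choose_spec
  rw [smul_eq_mul, mul_one] at this
  rw [this, translate_one]

/-- This is the hypothesis `hd` of `hasMFDerivAt_val` one level up, when `K` becomes the ambient
group of a further subgroup. -/
theorem chartAt_one_comp_hasFDerivAt (h : IsSliceChart K ι r e) :
    letI := h.chartedSpace
    HasFDerivAt (fun x => chartAt F (1 : K) (h.restrict.symm x)) (.id ℝ F) 0 := by
  let := h.chartedSpace
  refine (hasFDerivAt_id (0 : F)).congr_of_eventuallyEq ?_
  have : h.restrict.target ∈ 𝓝 (0 : F) :=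
    h.restrict.open_target.mem_nhds (h.restrict_one ▸ h.restrict.map_source h.one_mem_restrict)
  filter_upwards [this] with x hx
  rw [h.chartAt_one, h.restrict.right_inv hx]
  rfl

/-- The differential is computed in the preferred chart of `G` at `1`, which need not be `e`; `hd`
says that passing from `e` to it costs nothing to first order. -/
theorem hasMFDerivAt_val (h : IsSliceChart K ι r e)
    (hd : HasFDerivAt (fun x => chartAt E (1 : G) (e.symm x)) (.id ℝ E) 0) :
    letI := h.chartedSpace
    HasMFDerivAt 𝓘(ℝ, F) 𝓘(ℝ, E) (Subtype.val : K → G) 1 ι := by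
  let := h.chartedSpace
  refine ⟨continuous_subtype_val.continuousAt, ?_⟩
  have h0 : extChartAt 𝓘(ℝ, F) (1 : K) 1 = 0 := by
    simp [extChartAt, h.chartAt_one, h.restrict_one]
  rw [h0]
  refine HasFDerivAt.hasFDerivWithinAt ?_
  have hd' : HasFDerivAt (fun x => chartAt E (1 : G) (e.symm (ι x))) ι (0 : F) := by
    have := HasFDerivAt.comp (0 : F) (g := fun x => chartAt E (1 : G) (e.symm x)) (f := ι)
      (by rw [_root_.map_zero]; exact hd) ι.hasFDerivAt
    simpa using! this
  refine hd'.congr_of_eventuallyEq ?_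
  have : ι ⁻¹' e.target ∈ 𝓝 (0 : F) := (e.open_target.preimage ι.continuous).mem_nhds
    (by simpa using h.zero_mem_target)
  filter_upwards [this] with x hx
  simp [writtenInExtChartAt, extChartAt, h.chartAt_one, h.restrict_symm_coe hx]

variable [LieGroup 𝓘(ℝ, E) ω G]

theorem isManifold (h : IsSliceChart K ι r e) :
    letI := h.chartedSpace
    IsManifold 𝓘(ℝ, F) ω K := by
  apply isManifold_translatedChartedSpace
  intro k
  have he := (IsManifold.mem_maximalAtlas_iff_contMDiffOn _).1 h.mem_maximalAtlas
  have h1 : ContMDiffOn 𝓘(ℝ, E) 𝓘(ℝ, E) ω (fun v => e (k * e.symm v))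
      {v | v ∈ e.target ∧ (k : G) * e.symm v ∈ e.source} :=
    he.1.comp ((contMDiff_mul_left (a := (k : G))).comp_contMDiffOn
      (he.2.mono fun v hv => hv.1)) fun v hv => hv.2
  rw [contMDiffOn_iff_contDiffOn] at h1
  have h2 : ContDiffOn ℝ ω (fun x => r (e (k * e.symm (ι x))))
      {x | ι x ∈ e.target ∧ (k : G) * e.symm (ι x) ∈ e.source} :=
    r.contDiff.comp_contDiffOn (h1.comp ι.contDiff.contDiffOn fun x hx => hx)
  refine (h2.congr ?_).mono ?_
  · rintro x ⟨hx, -⟩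
    rw [restrict_apply, smul_eq_mul, Subgroup.coe_mul, h.restrict_symm_coe hx]
  · rintro x ⟨hx, hx'⟩
    refine ⟨hx, ?_⟩
    rw [← h.restrict_symm_coe hx]
    exact hx'

/-- In the translates by `k` of the two charts the inclusion is exactly `ι`, and the retraction `r`
identifies `E` with `F × r.ker`. -/
theorem isImmersion (h : IsSliceChart K ι r e) :
    letI := h.chartedSpace
    Manifold.IsImmersionOfComplement r.ker 𝓘(ℝ, F) 𝓘(ℝ, E) ω (Subtype.val : K → G) := by
  let := h.chartedSpace
  have := h.isManifold
  intro k
  refine Manifold.IsImmersionAtOfComplement.mk_of_charts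
    (ContinuousLinearEquiv.equivOfRightInverse r ι h.retract).symm
    (translate h.restrict k) (translate e (k : G)) ?_ ?_ ?_
    (translate_mem_maximalAtlas h.mem_maximalAtlas _) ?_ ?_
  · simpa [mem_translate_source] using h.one_mem_restrict
  · simpa [mem_translate_source] using h.one_mem
  · exact IsManifold.subset_maximalAtlas (h.translate_restrict_mem_atlas k)
  · intro k' hk'
    exact hk'
  · intro x hx
    have hx : ι x ∈ e.target := by simpa [translate_target] using! hx
    simp [translate_apply, translate_symm_apply, h.restrict_symm_coe hx, e.right_inv hx]

theorem isBanachLieSubgroup [CompleteSpace F] (h : IsSliceChart K ι r e) :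
    letI := h.chartedSpace
    IsBanachLieSubgroup E K F := by
  let := h.chartedSpace
  have := h.isManifold
  have him := h.isImmersion
  have hval := him.contMDiff
  refine ⟨inferInstance, ?_, him.isImmersion, Topology.IsEmbedding.subtypeVal⟩
  refine { contMDiff_mul := ?_, contMDiff_inv := ?_ }
  -- A continuous map into `K` is analytic once its composite with the immersion `K → G` is, so the
  -- operations inherit analyticity from `G`.
  · rw [ContMDiff.iff_comp_isImmersionOfComplement him]
    exact ⟨continuous_mul, (hval.comp contMDiff_fst).mul (hval.comp contMDiff_snd)⟩
  · rw [ContMDiff.iff_comp_isImmersionOfComplement him]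
    exact ⟨continuous_inv, hval.inv⟩

end IsSliceChart

end Slice

/-! ### Homogeneous spaces given by an adapted chart -/

section Homogeneous

variable {E : Type*} [NormedAddCommGroup E] [NormedSpace ℝ E]
  {G : Type*} [TopologicalSpace G] [ChartedSpace E G] [Group G]
  {B : Type*} [NormedAddCommGroup B] [NormedSpace ℝ B]
  {F : Type*} [NormedAddCommGroup F] [NormedSpace ℝ F]
  {M : Type*} [TopologicalSpace M] [MulAction G M]

/-- An analytic chart of `G` around `1` in which the fibres of the orbit map `g ↦ g • x₀` are the
fibres of the linear projection to `B`. -/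
structure IsAdaptedChart (x₀ : M) (L : E ≃L[ℝ] B × F) (Φ : OpenPartialHomeomorph G E) : Prop where
  mem_maximalAtlas : Φ ∈ IsManifold.maximalAtlas 𝓘(ℝ, E) ω G
  one_mem : (1 : G) ∈ Φ.source
  proj_mem_target : ∀ v ∈ Φ.target, L.symm ((L v).1, 0) ∈ Φ.target
  smul_eq_iff : ∀ g ∈ Φ.source, ∀ h ∈ Φ.source, g • x₀ = h • x₀ ↔ (L (Φ g)).1 = (L (Φ h)).1

variable {x₀ : M}

open Classical in
/-- The first component, in an adapted chart, of a point over `m`. -/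
def IsAdaptedChart.quotientCoord (x₀ : M) (L : E ≃L[ℝ] B × F) (Φ : OpenPartialHomeomorph G E) (m : M) : B :=
  if hm : ∃ g ∈ Φ.source, g • x₀ = m then (L (Φ hm.choose)).1 else 0

/-- The choice of representative is immaterial: points of `Φ.source` over the same `m` share their
first component. -/
theorem IsAdaptedChart.quotientCoord_smul {L : E ≃L[ℝ] B × F}
    {Φ : OpenPartialHomeomorph G E} (h : IsAdaptedChart x₀ L Φ) {g : G}
    (hg : g ∈ Φ.source) : IsAdaptedChart.quotientCoord x₀ L Φ (g • x₀) = (L (Φ g)).1 := by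
  have hm : ∃ g' ∈ Φ.source, g' • x₀ = g • x₀ := ⟨g, hg, rfl⟩
  rw [IsAdaptedChart.quotientCoord, dif_pos hm]
  exact (h.smul_eq_iff _ hm.choose_spec.1 _ hg).1 hm.choose_spec.2

theorem isPretransitive_of_isQuotientMap
    (hp : Topology.IsQuotientMap (fun g : G => g • x₀)) : MulAction.IsPretransitive G M where
  exists_smul_eq x y := by
    obtain ⟨g, rfl⟩ := hp.surjective x
    obtain ⟨h, rfl⟩ := hp.surjective y
    exact ⟨h * g⁻¹, by simp [mul_smul]⟩

variable [IsTopologicalGroup G]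

theorem continuousConstSMul_of_isQuotientMap
    (hp : Topology.IsQuotientMap (fun g : G => g • x₀)) : ContinuousConstSMul G M where
  continuous_const_smul g := by
    rw [hp.continuous_iff]
    have : (fun m : M => g • m) ∘ (fun h : G => h • x₀) = (fun h : G => h • x₀) ∘ (g * ·) := by
      ext h; simp [mul_smul]
    rw [this]
    exact hp.continuous.comp (continuous_const_mul g)

/-- The saturation of an open set is a union of its right translates by elements of the stabilizer
of `x₀`. -/
theorem isOpenMap_of_isQuotientMap
    (hp : Topology.IsQuotientMap (fun g : G => g • x₀)) : IsOpenMap (fun g : G => g • x₀) := by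
  intro U hU
  rw [← hp.isOpen_preimage, isOpen_iff_forall_mem_open]
  rintro g ⟨u, hu, hug⟩
  refine ⟨(fun g' => g' * (g⁻¹ * u)) ⁻¹' U, ?_, hU.preimage (continuous_mul_const _), ?_⟩
  · intro g' hg'
    have hk : (g⁻¹ * u) • x₀ = x₀ := by
      rw [mul_smul, inv_smul_eq_iff]; exact hug
    exact ⟨_, hg', by simp only [mul_smul] at hk ⊢; rw [hk]⟩
  · simpa using hu

namespace IsAdaptedChart

variable {L : E ≃L[ℝ] B × F} {Φ : OpenPartialHomeomorph G E}

/-- The chart of the homogeneous space induced by an adapted chart. -/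
def quotientChart (h : IsAdaptedChart x₀ L Φ)
    (hp : Topology.IsQuotientMap (fun g : G => g • x₀)) : OpenPartialHomeomorph M B where
  toFun := quotientCoord x₀ L Φ
  invFun b := Φ.symm (L.symm (b, 0)) • x₀
  source := (fun g : G => g • x₀) '' Φ.source
  target := {b | L.symm (b, 0) ∈ Φ.target}
  map_source' := by
    rintro _ ⟨g, hg, rfl⟩
    change L.symm (quotientCoord x₀ L Φ (g • x₀), 0) ∈ Φ.target
    rw [h.quotientCoord_smul hg]
    exact h.proj_mem_target _ (Φ.map_source hg)
  map_target' b hb := ⟨_, Φ.map_target hb, rfl⟩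
  left_inv' := by
    rintro _ ⟨g, hg, rfl⟩
    have ht := h.proj_mem_target _ (Φ.map_source hg)
    simp only [h.quotientCoord_smul hg]
    rw [h.smul_eq_iff _ (Φ.map_target ht) _ hg, Φ.right_inv ht, L.apply_symm_apply]
  right_inv' b hb := by
    rw [h.quotientCoord_smul (Φ.map_target hb), Φ.right_inv hb, L.apply_symm_apply]
  open_source := isOpenMap_of_isQuotientMap hp _ Φ.open_source
  open_target := Φ.open_target.preimage (by fun_prop)
  continuousOn_toFun := by
    rw [continuousOn_open_iff (isOpenMap_of_isQuotientMap hp _ Φ.open_source)]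
    intro t ht
    have : (fun g : G => g • x₀) '' Φ.source ∩ quotientCoord x₀ L Φ ⁻¹' t =
        (fun g : G => g • x₀) '' (Φ.source ∩ Φ ⁻¹' ((fun v => (L v).1) ⁻¹' t)) := by
      ext m
      constructor
      · rintro ⟨⟨g, hg, rfl⟩, hm⟩
        refine ⟨g, ⟨hg, ?_⟩, rfl⟩
        rw [Set.mem_preimage, h.quotientCoord_smul hg] at hm
        exact hm
      · rintro ⟨g, ⟨hg, hgt⟩, rfl⟩
        refine ⟨⟨g, hg, rfl⟩, ?_⟩
        rw [Set.mem_preimage, h.quotientCoord_smul hg]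
        exact hgt
    rw [this]
    exact isOpenMap_of_isQuotientMap hp _
      (Φ.isOpen_inter_preimage (ht.preimage (by fun_prop)))
  continuousOn_invFun := hp.continuous.comp_continuousOn
    (Φ.continuousOn_symm.comp (by fun_prop) fun b hb => hb)

variable (hp : Topology.IsQuotientMap (fun g : G => g • x₀))

theorem quotientChart_smul (h : IsAdaptedChart x₀ L Φ) {g : G} (hg : g ∈ Φ.source) :
    h.quotientChart hp (g • x₀) = (L (Φ g)).1 := h.quotientCoord_smul hg

theorem quotientChart_symm_apply (h : IsAdaptedChart x₀ L Φ) (b : B) :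
    (h.quotientChart hp).symm b = Φ.symm (L.symm (b, 0)) • x₀ := rfl

theorem smul_mem_quotientChart_source (h : IsAdaptedChart x₀ L Φ) {g : G} (hg : g ∈ Φ.source) :
    g • x₀ ∈ (h.quotientChart hp).source := ⟨g, hg, rfl⟩

theorem base_mem_quotientChart_source (h : IsAdaptedChart x₀ L Φ) :
    x₀ ∈ (h.quotientChart hp).source := ⟨1, h.one_mem, one_smul G x₀⟩

/-- The charted space structure on the homogeneous space induced by an adapted chart. -/
@[reducible]
def chartedSpace (h : IsAdaptedChart x₀ L Φ) : ChartedSpace B M :=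
  haveI := continuousConstSMul_of_isQuotientMap hp
  haveI := isPretransitive_of_isQuotientMap hp
  translatedChartedSpace G (h.quotientChart hp) x₀ (h.base_mem_quotientChart_source hp)

variable [LieGroup 𝓘(ℝ, E) ω G]

/-- The point `f n • x₀` may lie in the quotient chart although `f n` is outside `Φ.source`. Some
`k` in `Φ.source` has the same image, and right multiplication by the stabilizer element `(f n)⁻¹ *
k` moves `f` into `Φ.source` near `n` without changing the orbit points. -/
theorem contMDiffAt_quotientChart_comp (h : IsAdaptedChart x₀ L Φ)
    {E' : Type*} [NormedAddCommGroup E'] [NormedSpace ℝ E'] {H' : Type*} [TopologicalSpace H']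
    {I' : ModelWithCorners ℝ E' H'} {N : Type*} [TopologicalSpace N] [ChartedSpace H' N]
    {f : N → G} {n : N} (hf : ContMDiffAt I' 𝓘(ℝ, E) ω f n)
    (hn : f n • x₀ ∈ (h.quotientChart hp).source) :
    ContMDiffAt I' 𝓘(ℝ, B) ω (fun n => h.quotientChart hp (f n • x₀)) n := by
  obtain ⟨k, hk, hkn⟩ := hn
  have hk₀ : ((f n)⁻¹ * k) • x₀ = x₀ := by
    rw [mul_smul, inv_smul_eq_iff]; exact hkn
  have hf' : ContMDiffAt I' 𝓘(ℝ, E) ω (fun n' => f n' * ((f n)⁻¹ * k)) n :=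
    hf.mul contMDiffAt_const
  have hfn : f n * ((f n)⁻¹ * k) = k := by group
  have hΦ : ContMDiffAt 𝓘(ℝ, E) 𝓘(ℝ, E) ω Φ (f n * ((f n)⁻¹ * k)) :=
    contMDiffAt_of_mem_maximalAtlas h.mem_maximalAtlas (hfn.symm ▸ hk)
  have hL : ContMDiff 𝓘(ℝ, E) 𝓘(ℝ, B) ω (fun v => (L v).1) :=
    (contDiff_fst.comp L.contDiff).contMDiff
  refine (hL.contMDiffAt.comp n (hΦ.comp n hf')).congr_of_eventuallyEq ?_
  have := hf'.continuousAt.preimage_mem_nhds (Φ.open_source.mem_nhds (hfn.symm ▸ hk))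
  filter_upwards [this] with n' hn'
  have h1 : f n' • x₀ = (f n' * ((f n)⁻¹ * k)) • x₀ := by rw [mul_smul, hk₀]
  rw [h1, h.quotientChart_smul hp hn']
  rfl

theorem isManifold (h : IsAdaptedChart x₀ L Φ) :
    letI := h.chartedSpace hp
    IsManifold 𝓘(ℝ, B) ω M := by
  have := continuousConstSMul_of_isQuotientMap hp
  have := isPretransitive_of_isQuotientMap hp
  apply isManifold_translatedChartedSpace
  rintro g v ⟨hv, hv'⟩
  refine ContDiffAt.contDiffWithinAt ?_
  rw [← contMDiffAt_iff_contDiffAt]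
  have h1 : ContMDiffAt 𝓘(ℝ, B) 𝓘(ℝ, E) ω (fun b => L.symm (b, 0)) v :=
    (L.symm.contDiff.comp (contDiff_id.prodMk contDiff_const)).contMDiff.contMDiffAt
  have h2 : ContMDiffAt 𝓘(ℝ, E) 𝓘(ℝ, E) ω Φ.symm (L.symm (v, 0)) :=
    contMDiffAt_symm_of_mem_maximalAtlas h.mem_maximalAtlas hv
  have h3 := h.contMDiffAt_quotientChart_comp hp (contMDiffAt_const (c := g) |>.mul (h2.comp v h1))
    (by simpa [mul_smul, quotientChart_symm_apply] using! hv')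
  simpa [mul_smul, quotientChart_symm_apply] using! h3

theorem translate_mem_maximalAtlas (h : IsAdaptedChart x₀ L Φ) (g : G) :
    letI := h.chartedSpace hp
    haveI := continuousConstSMul_of_isQuotientMap hp
    translate (h.quotientChart hp) g ∈ IsManifold.maximalAtlas 𝓘(ℝ, B) ω M := by
  let := h.chartedSpace hp
  have := h.isManifold hp
  exact IsManifold.subset_maximalAtlas ⟨g, rfl⟩

/-- Left multiplication by `(f n)⁻¹` brings the orbit point back to `x₀`, where the base chart
applies; the translated chart then undoes it. -/
theorem contMDiffAt_smul_base (h : IsAdaptedChart x₀ L Φ)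
    {E' : Type*} [NormedAddCommGroup E'] [NormedSpace ℝ E'] {H' : Type*} [TopologicalSpace H']
    {I' : ModelWithCorners ℝ E' H'} {N : Type*} [TopologicalSpace N] [ChartedSpace H' N]
    {f : N → G} {n : N} (hf : ContMDiffAt I' 𝓘(ℝ, E) ω f n) :
    letI := h.chartedSpace hp
    ContMDiffAt I' 𝓘(ℝ, B) ω (fun n => f n • x₀) n := by
  let := h.chartedSpace hp
  have := continuousConstSMul_of_isQuotientMap hp
  have := h.isManifold hp
  have hb := h.base_mem_quotientChart_source hp
  have h1 := h.contMDiffAt_quotientChart_comp hp (contMDiffAt_const (c := (f n)⁻¹) |>.mul hf)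
    (by simpa using hb)
  have h2 : ContMDiffAt 𝓘(ℝ, B) 𝓘(ℝ, B) ω (translate (h.quotientChart hp) (f n)).symm
      (h.quotientChart hp (((f n)⁻¹ * f n) • x₀)) :=
    contMDiffAt_symm_of_mem_maximalAtlas (h.translate_mem_maximalAtlas hp (f n))
      (by simpa [translate_target] using (h.quotientChart hp).map_source hb)
  refine (h2.comp n h1).congr_of_eventuallyEq ?_
  have hc : ContinuousAt (fun n' => ((f n)⁻¹ * f n') • x₀) n :=
    hp.continuous.continuousAt.comp (continuousAt_const.mul hf.continuousAt)
  have := hc.preimage_mem_nhds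
    ((h.quotientChart hp).open_source.mem_nhds (by simpa using hb))
  filter_upwards [this] with n' hn'
  have h3 := (h.quotientChart hp).left_inv hn'
  change f n' • x₀ = (translate (h.quotientChart hp) (f n)).symm
    (h.quotientChart hp (((f n)⁻¹ * f n') • x₀))
  dsimp only at h3
  rw [translate_symm_apply, h3, mul_smul, smul_inv_smul]

/-- Near `g₁ • x₀` the orbit map has the analytic local section `m ↦ g₁ * Φ.symm (L.symm (κ m, 0))`,
with `κ` the translated chart. Through it the action becomes a product in `G` applied to `x₀`. -/
theorem contMDiffSMul (h : IsAdaptedChart x₀ L Φ) :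
    letI := h.chartedSpace hp
    ContMDiffSMul 𝓘(ℝ, E) 𝓘(ℝ, B) ω G M := by
  let := h.chartedSpace hp
  have := continuousConstSMul_of_isQuotientMap hp
  have := h.isManifold hp
  have hb := h.base_mem_quotientChart_source hp
  refine ⟨?_⟩
  rintro ⟨g, m⟩
  obtain ⟨g₁, rfl⟩ := hp.surjective m
  dsimp only
  have hs : g₁ • x₀ ∈ (translate (h.quotientChart hp) g₁).source := by
    simpa [mem_translate_source] using hb
  have h1 : ContMDiffAt 𝓘(ℝ, B) 𝓘(ℝ, B) ω (translate (h.quotientChart hp) g₁) (g₁ • x₀) :=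
    contMDiffAt_of_mem_maximalAtlas (h.translate_mem_maximalAtlas hp g₁) hs
  have ht : L.symm (translate (h.quotientChart hp) g₁ (g₁ • x₀), 0) ∈ Φ.target :=
    (translate (h.quotientChart hp) g₁).map_source hs
  have h2 : ContMDiffAt 𝓘(ℝ, B) 𝓘(ℝ, E) ω (fun b => L.symm (b, 0))
      (translate (h.quotientChart hp) g₁ (g₁ • x₀)) :=
    (L.symm.contDiff.comp (contDiff_id.prodMk contDiff_const)).contMDiff.contMDiffAt
  have h3 := contMDiffAt_symm_of_mem_maximalAtlas h.mem_maximalAtlas ht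
  have h4 : ContMDiffAt 𝓘(ℝ, B) 𝓘(ℝ, E) ω
      (fun m => g₁ * Φ.symm (L.symm (translate (h.quotientChart hp) g₁ m, 0))) (g₁ • x₀) :=
    contMDiffAt_const.mul (ContMDiffAt.comp (g₁ • x₀) (g := Φ.symm)
      (f := fun m => L.symm (translate (h.quotientChart hp) g₁ m, 0)) h3
      (ContMDiffAt.comp (g₁ • x₀) (g := fun b => L.symm (b, 0)) h2 h1))
  have h5 : ContMDiffAt (𝓘(ℝ, E).prod 𝓘(ℝ, B)) 𝓘(ℝ, E) ω
      (fun q : G × M => q.1 * (g₁ * Φ.symm (L.symm (translate (h.quotientChart hp) g₁ q.2, 0))))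
      (g, g₁ • x₀) :=
    contMDiffAt_fst.mul (ContMDiffAt.comp (g, g₁ • x₀) (f := Prod.snd) h4 contMDiffAt_snd)
  refine (h.contMDiffAt_smul_base hp h5).congr_of_eventuallyEq ?_
  have : (Prod.snd : G × M → M) ⁻¹' (translate (h.quotientChart hp) g₁).source ∈
      𝓝 (g, g₁ • x₀) :=
    continuous_snd.continuousAt.preimage_mem_nhds
      ((translate (h.quotientChart hp) g₁).open_source.mem_nhds hs)
  filter_upwards [this] with q hq
  have := (translate (h.quotientChart hp) g₁).left_inv hq
  rw [translate_symm_apply, quotientChart_symm_apply] at this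
  rw [mul_smul, mul_smul, this]

/-- The orbit map of `g₁ • x₀` is that of `x₀` after right multiplication by `g₁`. In `Φ`, suitably
translated on both sides, it is the projection `v ↦ (L v).1`. -/
theorem isSubmersion (h : IsAdaptedChart x₀ L Φ) (x : M) :
    letI := h.chartedSpace hp
    Manifold.IsSubmersionOfComplement F 𝓘(ℝ, E) 𝓘(ℝ, B) ω (fun g : G => g • x) := by
  let := h.chartedSpace hp
  have := continuousConstSMul_of_isQuotientMap hp
  have := h.isManifold hp
  obtain ⟨g₁, rfl⟩ := hp.surjective x
  dsimp only
  intro g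
  have hdom : (Homeomorph.mulRight g₁).transOpenPartialHomeomorph (translate Φ (g * g₁)) ∈
      IsManifold.maximalAtlas 𝓘(ℝ, E) ω G := by
    have h1 := KreinHomogeneous.translate_mem_maximalAtlas h.mem_maximalAtlas (g * g₁)
    rw [IsManifold.mem_maximalAtlas_iff_contMDiffOn] at h1 ⊢
    refine ⟨h1.1.comp (contMDiff_mul_right (a := g₁)).contMDiffOn fun x hx => hx, ?_⟩
    exact (contMDiff_mul_right (a := g₁⁻¹)).comp_contMDiffOn h1.2
  refine Manifold.IsSubmersionAtOfComplement.mk_of_charts L _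
    (translate (h.quotientChart hp) (g * g₁)) ?_ ?_ hdom (h.translate_mem_maximalAtlas hp _) ?_ ?_
  · change (g * g₁)⁻¹ * (g * g₁) ∈ Φ.source
    simpa using h.one_mem
  · simpa [mem_translate_source, ← mul_smul] using h.base_mem_quotientChart_source hp
  · intro g' hg'
    have : (g * g₁)⁻¹ * (g' * g₁) ∈ Φ.source := hg'
    simpa [mem_translate_source, ← mul_smul, mul_assoc] using
      h.smul_mem_quotientChart_source hp this
  · intro v hv
    have hv : v ∈ Φ.target := by simpa [translate_target] using! hv
    have : (((g * g₁) * Φ.symm v) * g₁⁻¹) • g₁ • x₀ = (g * g₁) • Φ.symm v • x₀ := by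
      simp [mul_smul]
    change h.quotientChart hp ((g * g₁)⁻¹ • (((translate Φ (g * g₁)).symm v) * g₁⁻¹) • g₁ • x₀) =
      (L v).1
    rw [translate_symm_apply, smul_eq_mul, this, inv_smul_smul,
      h.quotientChart_smul hp (Φ.map_target hv), Φ.right_inv hv]

theorem isAnalyticHomogeneousSpace [CompleteSpace B] [T2Space M] (h : IsAdaptedChart x₀ L Φ) :
    letI := h.chartedSpace hp
    IsAnalyticHomogeneousSpace E G B M := by
  let := h.chartedSpace hp
  exact ⟨inferInstance, inferInstance, h.isManifold hp, h.contMDiffSMul hp, ⟨x₀⟩,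
    isPretransitive_of_isQuotientMap hp, fun x => (h.isSubmersion hp x).isSubmersion⟩

end IsAdaptedChart

end Homogeneous

/-! ### Existence of adapted charts -/

namespace IsSliceChart

variable {E : Type*} [NormedAddCommGroup E] [NormedSpace ℝ E]
  {G : Type*} [TopologicalSpace G] [ChartedSpace E G] [Group G]
  {F : Type*} [NormedAddCommGroup F] [NormedSpace ℝ F]
  {K : Subgroup G} {ι : F →L[ℝ] E} {r : E →L[ℝ] F} {e : OpenPartialHomeomorph G E}

/-- The splitting of the model space given by a slice chart. -/
def split (h : IsSliceChart K ι r e) : E ≃L[ℝ] r.ker × F :=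
  (ContinuousLinearEquiv.equivOfRightInverse r ι h.retract).trans
    (ContinuousLinearEquiv.prodComm ℝ F r.ker)

theorem split_fst (h : IsSliceChart K ι r e) (x : E) : ((h.split x).1 : E) = x - ι (r x) := rfl

theorem split_symm_fst (h : IsSliceChart K ι r e) (x : E) :
    h.split.symm ((h.split x).1, 0) = x - ι (r x) := by
  change ι 0 + ((h.split x).1 : E) = _
  rw [_root_.map_zero, zero_add, h.split_fst]

theorem split_fst_eq_iff (h : IsSliceChart K ι r e) (x y : E) :
    (h.split x).1 = (h.split y).1 ↔ x - ι (r x) = y - ι (r y) := by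
  rw [← Subtype.coe_inj, split_fst, split_fst]

/-- This quantifies how close two transversal points must be for their quotient to be visible in `e`
and for the inverse function theorem to apply to `a + e(k)`. -/
theorem eventually_mem_source [IsTopologicalGroup G] (h : IsSliceChart K ι r e)
    {S : Set E} (hS : S ∈ 𝓝 (0 : E)) :
    ∃ U ∈ 𝓝 (0 : E), ∀ a ∈ U, ∀ b ∈ U, (e.symm a)⁻¹ * e.symm b ∈ e.source ∧
      a + e ((e.symm a)⁻¹ * e.symm b) ∈ S := by
  have hs : ContinuousAt e.symm 0 := e.continuousAt_symm h.zero_mem_target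
  have h1 : ContinuousAt (fun q : E × E => (e.symm q.1)⁻¹ * e.symm q.2) 0 :=
    (ContinuousAt.comp (x := (0 : E × E)) (g := e.symm) hs continuousAt_fst).inv.mul
      (ContinuousAt.comp (x := (0 : E × E)) (g := e.symm) hs continuousAt_snd)
  have he : ContinuousAt e ((e.symm (0 : E × E).1)⁻¹ * e.symm (0 : E × E).2) :=
    e.continuousAt (by simpa [h.symm_zero] using h.one_mem)
  have h2 : ContinuousAt (fun q : E × E => q.1 + e ((e.symm q.1)⁻¹ * e.symm q.2)) 0 :=
    continuousAt_fst.add (ContinuousAt.comp (x := (0 : E × E)) (g := e) he h1)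
  have h3 := h1.preimage_mem_nhds (e.open_source.mem_nhds
    (by simpa [h.symm_zero] using h.one_mem))
  have h4 := h2.preimage_mem_nhds (t := S) (by simpa [h.symm_zero, h.map_one] using hS)
  obtain ⟨U, hU, V, hV, hUV⟩ := mem_nhds_prod_iff.1 (Filter.inter_mem h3 h4)
  exact ⟨U ∩ V, Filter.inter_mem hU hV, fun a ha b hb => hUV (Set.mk_mem_prod ha.1 hb.2)⟩

variable [LieGroup 𝓘(ℝ, E) ω G]

theorem contDiffAt_symm_mul_symm (h : IsSliceChart K ι r e) :
    ContDiffAt ℝ ω (fun q : E × E => e (e.symm q.1 * e.symm q.2)) 0 := by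
  rw [← contMDiffAt_iff_contDiffAt]
  have h0 := h.symm_zero
  have hs : ContMDiffAt 𝓘(ℝ, E) 𝓘(ℝ, E) ω e.symm 0 :=
    contMDiffAt_symm_of_mem_maximalAtlas h.mem_maximalAtlas h.zero_mem_target
  have h1 : ContMDiffAt 𝓘(ℝ, E × E) 𝓘(ℝ, E) ω (fun q : E × E => e.symm q.1) 0 :=
    ContMDiffAt.comp (0 : E × E) (g := e.symm) hs contDiff_fst.contMDiff.contMDiffAt
  have h2 : ContMDiffAt 𝓘(ℝ, E × E) 𝓘(ℝ, E) ω (fun q : E × E => e.symm q.2) 0 :=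
    ContMDiffAt.comp (0 : E × E) (g := e.symm) hs contDiff_snd.contMDiff.contMDiffAt
  have he : ContMDiffAt 𝓘(ℝ, E) 𝓘(ℝ, E) ω e (e.symm (0 : E × E).1 * e.symm (0 : E × E).2) := by
    refine contMDiffAt_of_mem_maximalAtlas h.mem_maximalAtlas ?_
    simpa [h0] using h.one_mem
  exact ContMDiffAt.comp (0 : E × E) (g := e) he (h1.mul h2)

/-- Since `e.symm 0 = 1`, the product read in `e` is the identity on each axis near `0`, which
determines its derivative. -/
theorem hasFDerivAt_symm_mul_symm (h : IsSliceChart K ι r e) :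
    HasFDerivAt (fun q : E × E => e (e.symm q.1 * e.symm q.2))
      (ContinuousLinearMap.fst ℝ E E + ContinuousLinearMap.snd ℝ E E) 0 := by
  have hd := (h.contDiffAt_symm_mul_symm.differentiableAt (by simp)).hasFDerivAt
  set D := fderiv ℝ (fun q : E × E => e (e.symm q.1 * e.symm q.2)) 0
  have ht : e.target ∈ 𝓝 (0 : E) := e.open_target.mem_nhds h.zero_mem_target
  have h1 : D.comp (ContinuousLinearMap.inl ℝ E E) = .id ℝ E := by
    have h2 := HasFDerivAt.comp (0 : E) (f := ContinuousLinearMap.inl ℝ E E) (by simpa using! hd)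
      (ContinuousLinearMap.inl ℝ E E).hasFDerivAt
    refine h2.unique ((hasFDerivAt_id (0 : E)).congr_of_eventuallyEq ?_)
    filter_upwards [ht] with x hx
    simp [h.symm_zero, e.right_inv hx]
  have h1' : D.comp (ContinuousLinearMap.inr ℝ E E) = .id ℝ E := by
    have h2 := HasFDerivAt.comp (0 : E) (f := ContinuousLinearMap.inr ℝ E E) (by simpa using! hd)
      (ContinuousLinearMap.inr ℝ E E).hasFDerivAt
    refine h2.unique ((hasFDerivAt_id (0 : E)).congr_of_eventuallyEq ?_)
    filter_upwards [ht] with x hx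
    simp [h.symm_zero, e.right_inv hx]
  have hD : ContinuousLinearMap.fst ℝ E E + ContinuousLinearMap.snd ℝ E E = D := by
    refine ContinuousLinearMap.ext fun q => ?_
    have hq : q = ContinuousLinearMap.inl ℝ E E q.1 + ContinuousLinearMap.inr ℝ E E q.2 := by
      ext <;> simp
    have h2 : D (ContinuousLinearMap.inl ℝ E E q.1) = q.1 := DFunLike.congr_fun h1 q.1
    have h3 : D (ContinuousLinearMap.inr ℝ E E q.2) = q.2 := DFunLike.congr_fun h1' q.2
    conv_rhs => rw [hq, map_add, h2, h3]
    rfl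
  rw [hD]
  exact hd

/-- The product map `x ↦ e⁻¹(x - P x) e⁻¹(P x)`, `P = ι ∘ r`, read in the chart `e`. -/
def productMap (ι : F →L[ℝ] E) (r : E →L[ℝ] F) (e : OpenPartialHomeomorph G E) (x : E) : E :=
  e (e.symm (x - ι (r x)) * e.symm (ι (r x)))

theorem contDiffAt_productMap (h : IsSliceChart K ι r e) :
    ContDiffAt ℝ ω (productMap ι r e) 0 := by
  have h1 : ContDiff ℝ ω (fun x : E => (x - ι (r x), ι (r x))) := by fun_prop
  exact ContDiffAt.comp (0 : E) (g := fun q : E × E => e (e.symm q.1 * e.symm q.2))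
    (by simpa using! h.contDiffAt_symm_mul_symm) h1.contDiffAt

theorem hasFDerivAt_productMap (h : IsSliceChart K ι r e) :
    HasFDerivAt (productMap ι r e) ((ContinuousLinearEquiv.refl ℝ E : E ≃L[ℝ] E) : E →L[ℝ] E) 0 := by
  have h1 := HasFDerivAt.comp (0 : E) (g := fun q : E × E => e (e.symm q.1 * e.symm q.2))
    (f := ((.id ℝ E - ι.comp r).prod (ι.comp r) : E →L[ℝ] E × E))
    (by simpa using! h.hasFDerivAt_symm_mul_symm)
    ((.id ℝ E - ι.comp r).prod (ι.comp r) : E →L[ℝ] E × E).hasFDerivAt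
  refine h1.congr_fderiv (ContinuousLinearMap.ext fun x => ?_)
  change x - ι (r x) + ι (r x) = x
  exact sub_add_cancel _ _

theorem exists_isAdaptedChart [IsTopologicalGroup G] [CompleteSpace E] {M : Type*} [MulAction G M] {x₀ : M}
    (h : IsSliceChart (MulAction.stabilizer G x₀) ι r e) :
    ∃ Φ : OpenPartialHomeomorph G E, IsAdaptedChart x₀ h.split Φ := by
  have hω : (ω : WithTop ℕ∞) ≠ 0 := by simp
  let f : E → E := productMap ι r e
  have hf : ContDiffAt ℝ ω f 0 := h.contDiffAt_productMap
  have hf' := h.hasFDerivAt_productMap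
  have hPP : ∀ x, r (x - ι (r x)) = 0 := fun x => by simp [h.retract]
  have hf0 : f 0 = 0 := by simp [f, productMap, h.symm_zero, h.map_one]
  let l : OpenPartialHomeomorph E E := hf.toOpenPartialHomeomorph f hf' hω
  have hl0 : (0 : E) ∈ l.source := hf.mem_toOpenPartialHomeomorph_source hf' hω
  have hlf : ∀ x, l x = f x := fun x => rfl
  have hlsymm : ContDiffAt ℝ ω l.symm (f 0) := hf.to_localInverse hf' hω
  obtain ⟨U, hU, hU'⟩ := h.eventually_mem_source (l.open_source.mem_nhds hl0)
  have htarget : e.target ∈ 𝓝 (0 : E) := e.open_target.mem_nhds h.zero_mem_target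
  let P : E →L[ℝ] E := ι.comp r
  let Q : E →L[ℝ] E := .id ℝ E - P
  have hQ : ∀ x, Q x = x - ι (r x) := fun x => rfl
  have hP0 : P 0 = 0 := _root_.map_zero P
  have hQ0 : Q 0 = 0 := _root_.map_zero Q
  have hmul : ContinuousAt (fun x => e.symm (Q x) * e.symm (P x)) 0 := by
    refine ContinuousAt.mul ?_ ?_
    · exact ContinuousAt.comp (g := e.symm) (e.continuousAt_symm (by simp [h.zero_mem_target]))
        Q.continuous.continuousAt
    · exact ContinuousAt.comp (g := e.symm) (e.continuousAt_symm (by simp [h.zero_mem_target]))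
        P.continuous.continuousAt
  -- Analyticity of the local inverse is given only at `f 0`; being an open condition, it persists
  -- at `f x` for small `x`.
  have hA : ∀ᶠ x in 𝓝 (0 : E), x ∈ l.source ∧ x ∈ U ∧ Q x ∈ e.target ∧ P x ∈ e.target ∧
      e.symm (Q x) * e.symm (P x) ∈ e.source ∧ ContDiffAt ℝ ω l.symm (f x) := by
    filter_upwards [l.open_source.mem_nhds hl0, hU,
      Q.continuous.continuousAt.preimage_mem_nhds (by simpa using htarget),
      P.continuous.continuousAt.preimage_mem_nhds (by simpa using htarget),
      hmul.preimage_mem_nhds (e.open_source.mem_nhds (by simpa [h.symm_zero] using h.one_mem)),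
      hf.continuousAt.eventually (hlsymm.eventually (by simp))] with x h1 h2 h3 h4 h5 h6
    exact ⟨h1, h2, h3, h4, h5, h6⟩
  obtain ⟨O₁, hO₁, hO₁o, hO₁0⟩ := mem_nhds_iff.1 hA
  -- Intersecting with the preimage under the idempotent `Q` makes the domain stable under `Q`, as
  -- `proj_mem_target` requires.
  let O : Set E := O₁ ∩ Q ⁻¹' O₁
  have hOo : IsOpen O := hO₁o.inter (hO₁o.preimage Q.continuous)
  have hO0 : (0 : E) ∈ O := ⟨hO₁0, by simpa using hO₁0⟩
  have hQQ : ∀ x, Q (Q x) = Q x := fun x => by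
    rw [hQ (Q x), hQ x, hPP, _root_.map_zero, sub_zero]
  have hOQ : ∀ x ∈ O, Q x ∈ O := fun x hx => ⟨hx.2, by
    change Q (Q x) ∈ O₁
    rw [hQQ]; exact hx.2⟩
  let Φ : OpenPartialHomeomorph G E := e.trans (l.restrOpen O hOo).symm
  have hsymm : ∀ x ∈ O, e.symm (f x) = e.symm (Q x) * e.symm (P x) := fun x hx =>
    e.left_inv (hO₁ hx.1).2.2.2.2.1
  have hftarget : ∀ x ∈ O, f x ∈ e.target := fun x hx => e.map_source (hO₁ hx.1).2.2.2.2.1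
  have hΦsymm : ∀ x, Φ.symm x = e.symm (f x) := fun x => rfl
  have hΦtarget : Φ.target = O := by
    ext x
    simp only [Φ, OpenPartialHomeomorph.trans_target, OpenPartialHomeomorph.symm_target,
      OpenPartialHomeomorph.restrOpen_source, OpenPartialHomeomorph.symm_symm, Set.mem_inter_iff,
      Set.mem_preimage]
    exact ⟨fun hx => hx.1.2, fun hx => ⟨⟨(hO₁ hx.1).1, hx⟩, hftarget x hx⟩⟩
  have hsource : ∀ g ∈ Φ.source, Φ g ∈ O ∧ g = e.symm (Q (Φ g)) * e.symm (P (Φ g)) := by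
    intro g hg
    have h1 : Φ g ∈ O := hΦtarget ▸ Φ.map_source hg
    exact ⟨h1, by rw [← hsymm _ h1, ← hΦsymm, Φ.left_inv hg]⟩
  have hP : ∀ x ∈ O, e.symm (P x) • x₀ = x₀ := fun x hx => h.symm_mem (hO₁ hx.1).2.2.2.1
  -- Transversality: if two points of the slice `Q x`, `Q y` differ by `k` in the stabilizer, then
  -- `f (Q x + e k)` and `f (Q y)` both equal `Q y`. Injectivity of `f` gives `Q x + e k = Q y`, and
  -- applying `Q` kills `e k`.
  have hinj : ∀ x ∈ O, ∀ y ∈ O, e.symm (Q x) • x₀ = e.symm (Q y) • x₀ → Q x = Q y := by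
    intro x hx y hy hxy
    obtain ⟨h1, h2⟩ := hU' (Q x) (hO₁ (hOQ x hx).1).2.1 (Q y) (hO₁ (hOQ y hy).1).2.1
    set k := (e.symm (Q x))⁻¹ * e.symm (Q y) with hk
    have hkK : k ∈ MulAction.stabilizer G x₀ := by
      rw [MulAction.mem_stabilizer_iff, hk, mul_smul, inv_smul_eq_iff, hxy]
    have hke : ι (r (e k)) = e k := (h.mem_iff k h1).1 hkK
    have hr : r (Q x + e k) = r (e k) := by rw [map_add, hQ, hPP, zero_add]
    have hw : f (Q x + e k) = Q y := by
      simp only [f, productMap]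
      rw [hr, hke, add_sub_cancel_right, e.left_inv h1, hk, mul_inv_cancel_left,
        e.right_inv (hO₁ hy.1).2.2.1]
    have hy' : f (Q y) = Q y := by
      simp only [f, productMap]
      rw [hQ, hPP, _root_.map_zero, sub_zero, h.symm_zero, mul_one, ← hQ,
        e.right_inv (hO₁ hy.1).2.2.1]
    have heq := l.injOn h2 (hO₁ (hOQ y hy).1).1 (hw.trans hy'.symm)
    have := congrArg Q heq
    rwa [map_add, hQQ, hQQ, hQ (e k), hke, sub_self, add_zero] at this
  refine ⟨Φ, ?_, ?_, ?_, ?_⟩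
  · rw [IsManifold.mem_maximalAtlas_iff_contMDiffOn]
    refine ⟨fun g hg => ContMDiffAt.contMDiffWithinAt ?_, ?_⟩
    · have hge : g ∈ e.source := hg.1
      have h1 : e g = f (Φ g) := by
        rw [← e.right_inv (hftarget _ (hsource g hg).1), ← hΦsymm, Φ.left_inv hg]
      have h2 : ContMDiffAt 𝓘(ℝ, E) 𝓘(ℝ, E) ω l.symm (e g) := by
        rw [contMDiffAt_iff_contDiffAt, h1]
        exact (hO₁ (hsource g hg).1.1).2.2.2.2.2
      exact h2.comp g (contMDiffAt_of_mem_maximalAtlas h.mem_maximalAtlas hge)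
    · rw [hΦtarget]
      intro x hx
      have h1 : ContMDiffAt 𝓘(ℝ, E) 𝓘(ℝ, E) ω (fun x => e.symm (Q x)) x :=
        ContMDiffAt.comp x (g := e.symm)
          (contMDiffAt_symm_of_mem_maximalAtlas h.mem_maximalAtlas (hO₁ hx.1).2.2.1)
          Q.contDiff.contMDiff.contMDiffAt
      have h2 : ContMDiffAt 𝓘(ℝ, E) 𝓘(ℝ, E) ω (fun x => e.symm (P x)) x :=
        ContMDiffAt.comp x (g := e.symm)
          (contMDiffAt_symm_of_mem_maximalAtlas h.mem_maximalAtlas (hO₁ hx.1).2.2.2.1)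
          P.contDiff.contMDiff.contMDiffAt
      exact (h1.mul h2).contMDiffWithinAt.congr hsymm (hsymm x hx)
  · have h1 := Φ.map_target (hΦtarget.symm ▸ hO0)
    rwa [hΦsymm, hf0, h.symm_zero] at h1
  · intro v hv
    rw [hΦtarget] at hv ⊢
    rw [h.split_symm_fst]
    exact hOQ v hv
  · intro g hg g' hg'
    obtain ⟨h1, h2⟩ := hsource g hg
    obtain ⟨h1', h2'⟩ := hsource g' hg'
    rw [h.split_fst_eq_iff, ← hQ, ← hQ]
    have hgx : g • x₀ = e.symm (Q (Φ g)) • x₀ := by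
      conv_lhs => rw [h2]
      rw [mul_smul, hP _ h1]
    have hgx' : g' • x₀ = e.symm (Q (Φ g')) • x₀ := by
      conv_lhs => rw [h2']
      rw [mul_smul, hP _ h1']
    rw [hgx, hgx']
    exact ⟨hinj _ h1 _ h1', fun hh => by rw [hh]⟩

end IsSliceChart

/-! ### The Cayley chart -/

section Cayley

variable {A : Type*} [NormedRing A] [NormedAlgebra ℝ A]

theorem inverse_real_smul_unit {c : ℝ} (hc : c ≠ 0) (u : Aˣ) :
    IsUnit (c • (u : A)) ∧ Ring.inverse (c • (u : A)) = c⁻¹ • (↑u⁻¹ : A) := by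
  let w : Aˣ := ⟨c • (u : A), c⁻¹ • (↑u⁻¹ : A), by simp [hc], by simp [hc]⟩
  exact ⟨w.isUnit, Ring.inverse_unit w⟩

theorem one_add_one_eq_real_smul : (1 : A) + 1 = (2 : ℝ) • ((1 : Aˣ) : A) := by
  rw [Units.val_one, two_smul]

variable [CompleteSpace A]

variable (A) in
/-- The Cayley transform `U ↦ 2 (U - 1) (U + 1)⁻¹ = 2 - 4 (U + 1)⁻¹`, with inverse
`X ↦ (1 + X / 2) (1 - X / 2)⁻¹ = 4 (2 - X)⁻¹ - 1`. -/
def cayley : OpenPartialHomeomorph A A where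
  toFun U := (2 : ℝ) • (1 : A) - (4 : ℝ) • Ring.inverse (U + 1)
  invFun X := (4 : ℝ) • Ring.inverse ((2 : ℝ) • (1 : A) - X) - 1
  source := {U | IsUnit (U + 1)}
  target := {X | IsUnit ((2 : ℝ) • (1 : A) - X)}
  map_source' := by
    rintro U ⟨u, hu⟩
    simpa [← hu] using (inverse_real_smul_unit (four_ne_zero : (4 : ℝ) ≠ 0) u⁻¹).1
  map_target' := by
    rintro X ⟨u, hu⟩
    simpa [← hu] using (inverse_real_smul_unit (four_ne_zero : (4 : ℝ) ≠ 0) u⁻¹).1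
  left_inv' := by
    rintro U ⟨u, hu⟩
    simp only [← hu, sub_sub_cancel, Ring.inverse_unit]
    rw [(inverse_real_smul_unit (four_ne_zero : (4 : ℝ) ≠ 0) u⁻¹).2]
    simp [hu]
  right_inv' := by
    rintro X ⟨u, hu⟩
    simp only [← hu, sub_add_cancel, Ring.inverse_unit]
    rw [(inverse_real_smul_unit (four_ne_zero : (4 : ℝ) ≠ 0) u⁻¹).2]
    simp [hu]
  open_source := Units.isOpen.preimage (by fun_prop : Continuous fun U : A => U + 1)
  open_target := Units.isOpen.preimage (by fun_prop : Continuous fun X : A => (2 : ℝ) • (1 : A) - X)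
  continuousOn_toFun := by
    rintro U ⟨u, hu⟩
    have := (contDiffAt_ringInverse ℝ (n := 0) u).continuousAt
    rw [hu] at this
    refine ContinuousAt.continuousWithinAt ?_
    exact continuousAt_const.sub ((ContinuousAt.comp (g := Ring.inverse)
      (f := fun U : A => U + 1) this (continuousAt_id.add continuousAt_const)).const_smul _)
  continuousOn_invFun := by
    rintro X ⟨u, hu⟩
    have := (contDiffAt_ringInverse ℝ (n := 0) u).continuousAt
    rw [hu] at this
    refine ContinuousAt.continuousWithinAt ?_
    exact ((ContinuousAt.comp (g := Ring.inverse)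
      (f := fun X : A => (2 : ℝ) • (1 : A) - X) this (continuousAt_const.sub continuousAt_id)).const_smul _).sub continuousAt_const

theorem cayley_apply (U : A) :
    cayley A U = (2 : ℝ) • (1 : A) - (4 : ℝ) • Ring.inverse (U + 1) := rfl

theorem mem_cayley_source {U : A} : U ∈ (cayley A).source ↔ IsUnit (U + 1) := Iff.rfl

theorem one_mem_cayley_source : (1 : A) ∈ (cayley A).source := by
  rw [mem_cayley_source, one_add_one_eq_real_smul]
  exact (inverse_real_smul_unit two_ne_zero _).1

theorem cayley_one : cayley A 1 = 0 := by
  rw [cayley_apply, one_add_one_eq_real_smul, (inverse_real_smul_unit two_ne_zero _).2]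
  simp only [inv_one, Units.val_one, smul_smul]
  norm_num

theorem contDiffOn_cayley : ContDiffOn ℝ ω (cayley A) (cayley A).source := by
  rintro U ⟨u, hu⟩
  have := contDiffAt_ringInverse ℝ (n := ω) u
  rw [hu] at this
  refine ContDiffAt.contDiffWithinAt ?_
  exact contDiffAt_const.sub ((ContDiffAt.comp U (g := Ring.inverse) this
    (contDiffAt_id.add contDiffAt_const)).const_smul _)

theorem contDiffOn_cayley_symm : ContDiffOn ℝ ω (cayley A).symm (cayley A).target := by
  rintro U ⟨u, hu⟩
  have := contDiffAt_ringInverse ℝ (n := ω) u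
  rw [hu] at this
  refine ContDiffAt.contDiffWithinAt ?_
  exact ((ContDiffAt.comp U (g := Ring.inverse) this
    (contDiffAt_const.sub contDiffAt_id)).const_smul _).sub contDiffAt_const

/-- The normalisation is chosen for this: inversion at `2` contributes `-1/4`, the inner map `2 - X`
a sign, and the factor `4` restores the identity. -/
theorem hasFDerivAt_cayley_symm : HasFDerivAt (cayley A).symm (.id ℝ A) 0 := by
  let w : Aˣ := ⟨(2 : ℝ) • (1 : A), (2⁻¹ : ℝ) • (1 : A), by simp, by simp⟩
  have h1 : HasFDerivAt (𝕜 := ℝ) Ring.inverse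
      (-ContinuousLinearMap.mulLeftRight ℝ A (↑w⁻¹ : A) (↑w⁻¹ : A)) ((2 : ℝ) • (1 : A) - 0) := by
    rw [sub_zero]; exact hasFDerivAt_ringInverse (𝕜 := ℝ) w
  have h1' : HasFDerivAt (fun X : A => (2 : ℝ) • (1 : A) - X) (-.id ℝ A) 0 :=
    (hasFDerivAt_id (𝕜 := ℝ) (0 : A)).const_sub _
  have h2 := ((h1.comp (0 : A) h1').const_smul (4 : ℝ)).sub_const (1 : A)
  refine h2.congr_fderiv (ContinuousLinearMap.ext fun x => ?_)
  simp only [w, smul_apply, ContinuousLinearMap.comp_apply,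
    neg_apply, ContinuousLinearMap.mulLeftRight_apply,
    ContinuousLinearMap.id_apply, Units.inv_mk, smul_mul_assoc, one_mul, mul_neg, mul_smul_comm,
    mul_one, smul_neg, neg_neg, smul_smul]
  norm_num

/-- Shifting by scalars, scaling by nonzero reals and inverting do not change the commutant. -/
theorem commute_cayley_iff {U Q : A} (hU : IsUnit (U + 1)) :
    Commute (cayley A U) Q ↔ Commute U Q := by
  obtain ⟨u, hu⟩ := hU
  rw [cayley_apply, ← hu, Ring.inverse_unit]
  have h1 : Commute U Q ↔ Commute (u : A) Q := by
    rw [hu]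
    exact ⟨fun h => h.add_left (Commute.one_left Q), fun h => by
      simpa using h.sub_left (Commute.one_left Q)⟩
  rw [h1, ← Commute.units_inv_left_iff]
  constructor
  · intro h
    have h2 := (((Commute.one_left Q).smul_left (2 : ℝ)).sub_left h).smul_left (4⁻¹ : ℝ)
    simpa using h2
  · intro h
    exact ((Commute.one_left Q).smul_left (2 : ℝ)).sub_left (h.smul_left (4 : ℝ))

variable (A) in
/-- The Cayley transform as a chart of the group of units. -/
def cayleyChart : OpenPartialHomeomorph Aˣ A := (chartAt A (1 : Aˣ)).trans (cayley A)

theorem cayleyChart_apply (u : Aˣ) : cayleyChart A u = cayley A u := rfl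

theorem mem_cayleyChart_source {u : Aˣ} :
    u ∈ (cayleyChart A).source ↔ IsUnit ((u : A) + 1) := by
  simp [cayleyChart, mem_cayley_source]

theorem cayleyChart_mem_maximalAtlas :
    cayleyChart A ∈ IsManifold.maximalAtlas 𝓘(ℝ, A) ω Aˣ := by
  rw [IsManifold.mem_maximalAtlas_iff_contMDiffOn]
  have h : chartAt A (1 : Aˣ) ∈ IsManifold.maximalAtlas 𝓘(ℝ, A) ω Aˣ :=
    IsManifold.chart_mem_maximalAtlas 1
  refine ⟨contDiffOn_cayley.contMDiffOn.comp
    ((contMDiffOn_of_mem_maximalAtlas h).mono fun x hx => hx.1) fun x hx => hx.2, ?_⟩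
  exact (contMDiffOn_symm_of_mem_maximalAtlas h).comp
    (contDiffOn_cayley_symm.contMDiffOn.mono fun x hx => hx.1) fun x hx => hx.2

theorem chartAt_one_comp_cayleyChart_symm :
    HasFDerivAt (fun x => chartAt A (1 : Aˣ) ((cayleyChart A).symm x)) (.id ℝ A) 0 := by
  refine hasFDerivAt_cayley_symm.congr_of_eventuallyEq ?_
  have h1 : (1 : Aˣ) ∈ (cayleyChart A).source := mem_cayleyChart_source.2 one_mem_cayley_source
  have h0 : (0 : A) ∈ (cayleyChart A).target := by
    have := (cayleyChart A).map_source h1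
    rwa [cayleyChart_apply, Units.val_one, cayley_one] at this
  filter_upwards [(cayleyChart A).open_target.mem_nhds h0] with x hx
  exact (chartAt A (1 : Aˣ)).right_inv hx.2

end Cayley

/-! ### The groups `𝒰_J` and their isotropy groups -/

section Krein

variable {H : Type*} [NormedAddCommGroup H] [InnerProductSpace ℂ H] [CompleteSpace H]
  (J : FundamentalSymmetry H)

/-- The `J`-adjoint as a continuous real linear map. -/
def jAdjointL : (H →L[ℂ] H) →L[ℝ] (H →L[ℂ] H) where
  toFun := jAdjoint J
  map_add' := jAdjoint_add J
  map_smul' c T := jAdjoint_real_smul J c T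
  cont := (continuous_const.mul ContinuousLinearMap.adjoint.continuous).mul continuous_const

theorem jAdjoint_sub (S T : H →L[ℂ] H) : jAdjoint J (S - T) = jAdjoint J S - jAdjoint J T :=
  map_sub (jAdjointL J) S T

theorem mem_jAntihermitian {X : H →L[ℂ] H} : X ∈ jAntihermitian J ↔ jAdjoint J X = -X := Iff.rfl

theorem mem_jUnitary_iff {U : (H →L[ℂ] H)ˣ} :
    U ∈ jUnitary J ↔ (U : H →L[ℂ] H) * jAdjoint J U = 1 := by
  refine ⟨fun h => h.1, fun h => ⟨h, ?_⟩⟩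
  rw [← Units.inv_eq_of_mul_eq_one_right h, Units.inv_mul]

theorem isClosed_jAntihermitian : IsClosed (jAntihermitian J : Set (H →L[ℂ] H)) :=
  isClosed_eq (jAdjointL J).continuous continuous_neg

instance : CompleteSpace (jAntihermitian J) := (isClosed_jAntihermitian J).completeSpace_coe

/-- The projection `X ↦ (X - X^#) / 2` onto the `J`-antihermitian operators. -/
def antihermitianPart : (H →L[ℂ] H) →L[ℝ] jAntihermitian J :=
  ((2⁻¹ : ℝ) • (.id ℝ (H →L[ℂ] H) - jAdjointL J)).codRestrict (jAntihermitian J) fun X => by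
    rw [mem_jAntihermitian]
    change jAdjoint J ((2⁻¹ : ℝ) • (X - jAdjoint J X)) = -((2⁻¹ : ℝ) • (X - jAdjoint J X))
    rw [jAdjoint_real_smul, jAdjoint_sub, jAdjoint_jAdjoint, ← smul_neg, neg_sub]

theorem coe_antihermitianPart (X : H →L[ℂ] H) :
    (antihermitianPart J X : H →L[ℂ] H) = (2⁻¹ : ℝ) • (X - jAdjoint J X) := rfl

theorem coe_antihermitianPart_eq_iff {X : H →L[ℂ] H} :
    (antihermitianPart J X : H →L[ℂ] H) = X ↔ X ∈ jAntihermitian J := by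
  rw [mem_jAntihermitian, coe_antihermitianPart]
  constructor
  · intro h
    have h2 : X - jAdjoint J X = (2 : ℝ) • X := by
      conv_rhs => rw [← h]
      simp
    rw [← sub_sub_cancel X (jAdjoint J X), h2, two_smul]
    abel
  · intro h
    rw [h, sub_neg_eq_add, ← two_smul ℝ X, smul_smul]
    norm_num

theorem jAdjoint_inv {u : (H →L[ℂ] H)ˣ} :
    (u : H →L[ℂ] H) * (↑u⁻¹ + jAdjoint J ↑u⁻¹) * jAdjoint J u = jAdjoint J u + u := by
  have h : jAdjoint J (↑u⁻¹ : H →L[ℂ] H) * jAdjoint J u = 1 := by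
    rw [← jAdjoint_mul, Units.mul_inv, jAdjoint_one]
  rw [mul_add, add_mul, Units.mul_inv, one_mul, mul_assoc, h, mul_one]

/-- With `u = U + 1`, antihermiticity of `2 - 4 u⁻¹` says `u⁻¹ + (u⁻¹)^# = 1`. Multiplying by `u` on
the left and `u^#` on the right gives `u^# + u = u u^#`, which expands to `U U^# = 1`. -/
theorem mem_jUnitary_iff_cayley {U : (H →L[ℂ] H)ˣ} (hU : IsUnit ((U : H →L[ℂ] H) + 1)) :
    U ∈ jUnitary J ↔ cayley (H →L[ℂ] H) U ∈ jAntihermitian J := by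
  obtain ⟨u, hu⟩ := hU
  have hu' : jAdjoint J (u : H →L[ℂ] H) = jAdjoint J U + 1 := by
    rw [hu, jAdjoint_add, jAdjoint_one]
  have hunit : IsUnit (jAdjoint J (u : H →L[ℂ] H)) :=
    ⟨⟨jAdjoint J u, jAdjoint J ↑u⁻¹, by rw [← jAdjoint_mul, Units.inv_mul, jAdjoint_one],
      by rw [← jAdjoint_mul, Units.mul_inv, jAdjoint_one]⟩, rfl⟩
  have h1 : cayley (H →L[ℂ] H) U ∈ jAntihermitian J ↔
      (↑u⁻¹ : H →L[ℂ] H) + jAdjoint J ↑u⁻¹ = 1 := by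
    rw [mem_jAntihermitian, cayley_apply, ← hu, Ring.inverse_unit, jAdjoint_sub,
      jAdjoint_real_smul, jAdjoint_real_smul, jAdjoint_one, eq_neg_iff_add_eq_zero]
    have : (2 : ℝ) • (1 : H →L[ℂ] H) - (4 : ℝ) • jAdjoint J ↑u⁻¹ + ((2 : ℝ) • 1 - (4 : ℝ) • ↑u⁻¹) =
        (4 : ℝ) • (1 - ((↑u⁻¹ : H →L[ℂ] H) + jAdjoint J ↑u⁻¹)) := by module
    rw [this, smul_eq_zero_iff_right four_ne_zero, sub_eq_zero, eq_comm]
  have h2 : (↑u⁻¹ : H →L[ℂ] H) + jAdjoint J ↑u⁻¹ = 1 ↔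
      jAdjoint J (u : H →L[ℂ] H) + u = u * jAdjoint J u := by
    rw [← jAdjoint_inv]
    constructor
    · intro h
      rw [h, mul_one]
    · intro h
      have h3 := hunit.mul_left_injective h
      exact u.isUnit.mul_right_injective (h3.trans (mul_one _).symm)
  rw [h1, h2, mem_jUnitary_iff, hu', hu, add_mul, mul_add, one_mul, mul_one, ← sub_eq_zero,
    ← sub_eq_zero (a := jAdjoint J (U : H →L[ℂ] H) + 1 + (U + 1))]
  constructor
  · intro h
    rw [sub_eq_zero] at h
    rw [h]; abel
  · intro h
    rw [← neg_eq_zero, ← h]; abel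

theorem isSliceChart_jUnitary :
    IsSliceChart (jUnitary J) (jAntihermitian J).subtypeL (antihermitianPart J)
      (cayleyChart (H →L[ℂ] H)) where
  retract X := Subtype.ext ((coe_antihermitianPart_eq_iff J).2 X.2)
  mem_maximalAtlas := cayleyChart_mem_maximalAtlas
  one_mem := mem_cayleyChart_source.2 one_mem_cayley_source
  map_one := by rw [cayleyChart_apply, Units.val_one, cayley_one]
  mem_iff U hU := by
    rw [mem_jUnitary_iff_cayley J (mem_cayleyChart_source.1 hU)]
    exact (coe_antihermitianPart_eq_iff J).symm

/-! ### The projection onto the isotropy algebra -/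

/-- The compression `X ↦ Q X Q + (1 - Q) X (1 - Q)`. -/
def compression (Q : H →L[ℂ] H) : (H →L[ℂ] H) →L[ℝ] (H →L[ℂ] H) :=
  ContinuousLinearMap.mulLeftRight ℝ (H →L[ℂ] H) Q Q +
    ContinuousLinearMap.mulLeftRight ℝ (H →L[ℂ] H) (1 - Q) (1 - Q)

theorem compression_apply (Q X : H →L[ℂ] H) :
    compression Q X = Q * X * Q + (1 - Q) * X * (1 - Q) := rfl

theorem compression_commute {Q : H →L[ℂ] H} (hQ : Q * Q = Q) (X : H →L[ℂ] H) :
    Commute (compression Q X) Q := by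
  have h1 : (1 - Q) * Q = 0 := by rw [sub_mul, hQ, one_mul, sub_self]
  have h2 : Q * (1 - Q) = 0 := by rw [mul_sub, hQ, mul_one, sub_self]
  change compression Q X * Q = Q * compression Q X
  rw [compression_apply, add_mul, mul_add, mul_assoc _ Q Q, hQ, mul_assoc _ (1 - Q) Q, h1,
    mul_zero, mul_assoc (1 - Q), ← mul_assoc Q (1 - Q), h2, zero_mul, mul_assoc Q X Q,
    ← mul_assoc Q Q, hQ]

theorem compression_eq_self {Q X : H →L[ℂ] H} (hQ : Q * Q = Q) (hX : Commute X Q) :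
    compression Q X = X := by
  have h1 : (1 - Q) * (1 - Q) = 1 - Q := by
    simp [sub_mul, mul_sub, hQ]
  have h2 : Commute X (1 - Q) := (Commute.one_right X).sub_right hX
  rw [compression_apply, mul_assoc, hX.eq, ← mul_assoc, hQ, mul_assoc, h2.eq, ← mul_assoc, h1,
    ← add_mul]
  simp

theorem Commute.compression_left {P Q X : H →L[ℂ] H} (hPQ : Commute P Q) (hX : Commute X Q) :
    Commute (compression P X) Q := by
  have h2 : Commute (1 - P) Q := (Commute.one_left Q).sub_left hPQ
  exact ((hPQ.mul_left hX).mul_left hPQ).add_left ((h2.mul_left hX).mul_left h2)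

theorem mul_mul_comm_of_commute {A : Type*} [Semigroup A] {a b : A} (h : Commute a b) (x : A) :
    a * (b * x * b) * a = b * (a * x * a) * b := by
  calc a * (b * x * b) * a = (a * b) * x * (b * a) := by simp only [mul_assoc]
    _ = (b * a) * x * (a * b) := by rw [h.eq]
    _ = _ := by simp only [mul_assoc]

/-- Each compression is a sum of two-sided multiplications by `Q` and `1 - Q`, and all these factors
commute with those of `P`. -/
theorem compression_comm {P Q : H →L[ℂ] H} (h : Commute P Q) (X : H →L[ℂ] H) :
    compression P (compression Q X) = compression Q (compression P X) := by
  have h1 : Commute (1 - P) Q := (Commute.one_left Q).sub_left h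
  have h2 : Commute P (1 - Q) := (Commute.one_right P).sub_right h
  have h3 : Commute (1 - P) (1 - Q) := (Commute.one_right _).sub_right h1
  simp only [compression_apply, mul_add, add_mul] at *
  rw [mul_mul_comm_of_commute h, mul_mul_comm_of_commute h1, mul_mul_comm_of_commute h2,
    mul_mul_comm_of_commute h3]
  abel

theorem jAdjoint_compression (Q X : H →L[ℂ] H) :
    jAdjoint J (compression Q X) = compression (jAdjoint J Q) (jAdjoint J X) := by
  simp only [compression_apply, jAdjoint_add, jAdjoint_mul, jAdjoint_sub, jAdjoint_one, mul_assoc]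

variable {J} (Q₀ : jNormalProjections J)

theorem jNormalProjections.idempotent : (Q₀ : H →L[ℂ] H) * Q₀ = Q₀ := Q₀.2.1

theorem jNormalProjections.commute : Commute (jAdjoint J (Q₀ : H →L[ℂ] H)) Q₀ := Q₀.2.2.symm

theorem jNormalProjections.jAdjoint_idempotent :
    jAdjoint J (Q₀ : H →L[ℂ] H) * jAdjoint J Q₀ = jAdjoint J Q₀ := by
  rw [← jAdjoint_mul, Q₀.2.1]

theorem mem_isotropyAntihermitian {X : H →L[ℂ] H} : X ∈ isotropyAntihermitian J Q₀ ↔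
    X ∈ jAntihermitian J ∧ Commute X (Q₀ : H →L[ℂ] H) := Iff.rfl

theorem isClosed_isotropyAntihermitian :
    IsClosed (isotropyAntihermitian J Q₀ : Set (H →L[ℂ] H)) :=
  (isClosed_jAntihermitian J).inter
    (isClosed_eq (continuous_mul_const _) (continuous_const_mul _))

instance : CompleteSpace (isotropyAntihermitian J Q₀) :=
  (isClosed_isotropyAntihermitian Q₀).completeSpace_coe

/-- The inclusion of `𝔤` in `𝔲_J`. -/
def isotropyInclusion : isotropyAntihermitian J Q₀ →L[ℝ] jAntihermitian J :=
  (isotropyAntihermitian J Q₀).subtypeL.codRestrict (jAntihermitian J) fun X => X.2.1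

theorem coe_isotropyInclusion (X : isotropyAntihermitian J Q₀) :
    (isotropyInclusion Q₀ X : H →L[ℂ] H) = X := rfl

/-- The `J`-adjoint swaps the two compressions, so it is their commutation, hence the normality of
`Q₀`, that keeps the result in `𝔲_J`. -/
theorem compression_mem {X : H →L[ℂ] H} (hX : X ∈ jAntihermitian J) :
    compression (jAdjoint J Q₀) (compression (Q₀ : H →L[ℂ] H) X) ∈ isotropyAntihermitian J Q₀ := by
  rw [mem_isotropyAntihermitian, mem_jAntihermitian]
  refine ⟨?_, Commute.compression_left (jNormalProjections.commute Q₀)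
    (compression_commute (jNormalProjections.idempotent Q₀) X)⟩
  rw [jAdjoint_compression, jAdjoint_compression, jAdjoint_jAdjoint, (mem_jAntihermitian J).1 hX,
    compression_comm (jNormalProjections.commute Q₀).symm, map_neg, map_neg]

/-- Take the `J`-adjoint of `X Q₀ = Q₀ X`; the signs from `X^# = -X` cancel. -/
theorem commute_jAdjoint {X : H →L[ℂ] H} (hX : X ∈ isotropyAntihermitian J Q₀) :
    Commute X (jAdjoint J Q₀) := by
  have h := congrArg (jAdjoint J) hX.2
  rw [jAdjoint_mul, jAdjoint_mul, (mem_jAntihermitian J).1 hX.1, mul_neg, neg_mul, neg_inj] at h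
  exact h.symm

/-- The projection of `𝔲_J` onto `𝔤`. -/
def isotropyProjection : jAntihermitian J →L[ℝ] isotropyAntihermitian J Q₀ :=
  (((compression (jAdjoint J Q₀)).comp (compression (Q₀ : H →L[ℂ] H))).comp
    (jAntihermitian J).subtypeL).codRestrict _ fun X => compression_mem Q₀ X.2

theorem coe_isotropyProjection (X : jAntihermitian J) :
    (isotropyProjection Q₀ X : H →L[ℂ] H) =
      compression (jAdjoint J Q₀) (compression (Q₀ : H →L[ℂ] H) X) := rfl

theorem isotropyProjection_inclusion (X : isotropyAntihermitian J Q₀) :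
    isotropyProjection Q₀ (isotropyInclusion Q₀ X) = X := by
  apply Subtype.ext
  rw [coe_isotropyProjection, coe_isotropyInclusion,
    compression_eq_self (jNormalProjections.idempotent Q₀) X.2.2,
    compression_eq_self (jNormalProjections.jAdjoint_idempotent Q₀) (commute_jAdjoint Q₀ X.2)]

theorem isotropyInclusion_projection_eq_iff (X : jAntihermitian J) :
    isotropyInclusion Q₀ (isotropyProjection Q₀ X) = X ↔
      Commute (X : H →L[ℂ] H) (Q₀ : H →L[ℂ] H) := by
  constructor
  · intro h
    rw [← h]
    exact (isotropyProjection Q₀ X).2.2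
  · intro h
    have := isotropyProjection_inclusion Q₀ ⟨X, X.2, h⟩
    exact congrArg (isotropyInclusion Q₀) this

theorem coe_smul_jNormalProjections (U : jUnitary J) :
    ((U • Q₀ : jNormalProjections J) : H →L[ℂ] H) =
      (U : (H →L[ℂ] H)ˣ) * (Q₀ : H →L[ℂ] H) * jAdjoint J (U : (H →L[ℂ] H)ˣ) := rfl

theorem mem_isotropy_iff {U : jUnitary J} :
    U ∈ isotropy J Q₀ ↔ Commute ((U : (H →L[ℂ] H)ˣ) : H →L[ℂ] H) (Q₀ : H →L[ℂ] H) := by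
  rw [MulAction.mem_stabilizer_iff, ← Subtype.coe_inj, coe_smul_jNormalProjections]
  obtain ⟨h1, h2⟩ := U.2
  constructor
  · intro h
    change _ * _ = _ * _
    conv_rhs => rw [← h]
    rw [mul_assoc, h2, mul_one]
  · intro h
    rw [h.eq, mul_assoc, h1, mul_one]

/-- The chart of `𝒰_J` is still the Cayley transform, which preserves and reflects commutation with
`Q₀`; membership in the isotropy group thus becomes membership in `𝔤`. -/
theorem isSliceChart_isotropy :
    letI := (isSliceChart_jUnitary J).chartedSpace
    IsSliceChart (isotropy J Q₀) (isotropyInclusion Q₀) (isotropyProjection Q₀)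
      (isSliceChart_jUnitary J).restrict := by
  let := (isSliceChart_jUnitary J).chartedSpace
  have := (isSliceChart_jUnitary J).isManifold
  refine ⟨isotropyProjection_inclusion Q₀, ?_, (isSliceChart_jUnitary J).one_mem_restrict,
    (isSliceChart_jUnitary J).restrict_one, ?_⟩
  · rw [← (isSliceChart_jUnitary J).chartAt_one]
    exact IsManifold.chart_mem_maximalAtlas 1
  · intro U hU
    have hU' : (U : (H →L[ℂ] H)ˣ) ∈ (cayleyChart (H →L[ℂ] H)).source := hU
    have h1 : ((isSliceChart_jUnitary J).restrict U : H →L[ℂ] H) =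
        cayley (H →L[ℂ] H) (U : (H →L[ℂ] H)ˣ) :=
      ((isSliceChart_jUnitary J).mem_iff _ hU').1 U.2
    rw [isotropyInclusion_projection_eq_iff, h1, mem_isotropy_iff,
      commute_cayley_iff (mem_cayleyChart_source.1 hU')]

theorem range_isotropyInclusion : (isotropyInclusion Q₀).range =
    (isotropyAntihermitian J Q₀).submoduleOf (jAntihermitian J) := by
  ext X
  constructor
  · rintro ⟨Y, rfl⟩
    exact Y.2
  · intro hX
    exact ⟨⟨X, hX⟩, rfl⟩

theorem map_range_isotropyInclusion : (isotropyInclusion Q₀).range.map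
    (jAntihermitian J).subtypeL.toLinearMap = isotropyAntihermitian J Q₀ := by
  rw [range_isotropyInclusion]
  ext X
  constructor
  · rintro ⟨Y, hY, rfl⟩
    exact hY
  · intro hX
    exact ⟨⟨X, hX.1⟩, hX, rfl⟩

theorem closedComplemented_range_isotropyInclusion :
    (isotropyInclusion Q₀).range.ClosedComplemented := by
  refine ⟨((isotropyInclusion Q₀).comp (isotropyProjection Q₀)).codRestrict _ fun X => ⟨_, rfl⟩, ?_⟩
  rintro ⟨_, Y, rfl⟩
  apply Subtype.ext
  change isotropyInclusion Q₀ (isotropyProjection Q₀ (isotropyInclusion Q₀ Y)) = _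
  rw [isotropyProjection_inclusion]
  rfl

/-! ### The orbit -/

/-- The point `Q₀` of its orbit. -/
def basePoint : OrbitSpace J Q₀ := ⟨Q₀, MulAction.mem_orbit_self Q₀⟩

theorem isQuotientMap_smul_basePoint :
    Topology.IsQuotientMap (fun U : jUnitary J => U • basePoint Q₀) := by
  refine ⟨⟨rfl⟩, ?_⟩
  rintro ⟨_, U, rfl⟩
  exact ⟨U, rfl⟩

theorem stabilizer_basePoint :
    MulAction.stabilizer (jUnitary J) (basePoint Q₀) = isotropy J Q₀ := by
  ext U
  rw [MulAction.mem_stabilizer_iff, MulAction.mem_stabilizer_iff]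
  exact Subtype.ext_iff

/-- The quotient topology is finer than the one induced by the norm, since `U ↦ U Q₀ U^#` is norm
continuous; the latter is already Hausdorff. -/
instance : T2Space (OrbitSpace J Q₀) := by
  let f : OrbitSpace J Q₀ → (H →L[ℂ] H) := fun Q => (Q.1 : jNormalProjections J)
  have hf : Function.Injective f := fun P Q h => Subtype.ext (Subtype.ext h)
  refine T2Space.of_injective_continuous hf (continuous_coinduced_dom.2 ?_)
  have h1 : Continuous fun U : jUnitary J => ((U : (H →L[ℂ] H)ˣ) : H →L[ℂ] H) :=
    Units.continuous_val.comp continuous_subtype_val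
  exact (h1.mul continuous_const).mul ((jAdjointL J).continuous.comp h1)

end Krein

end KreinHomogeneous

end

theorem mainTheorem5 {H : Type u} [NormedAddCommGroup H] [InnerProductSpace ℂ H]
    [CompleteSpace H] [TopologicalSpace.SeparableSpace H]
    (J : FundamentalSymmetry H) (Q₀ : jNormalProjections J) :
    -- the Banach–Lie group structure of `𝒰_J`, as a Banach–Lie subgroup of `GL(H)` with
    -- Lie algebra `𝔲_J`
    ∃ _ : ChartedSpace (jAntihermitian J) (jUnitary J),
      IsBanachLieSubgroup (H →L[ℂ] H) (jUnitary J) (jAntihermitian J) ∧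
      subgroupLieAlgebra (H →L[ℂ] H) (jUnitary J) (jAntihermitian J) = jAntihermitian J ∧
      -- the isotropy group is a Banach–Lie subgroup of `𝒰_J`; its Lie algebra is `𝔤` and is
      -- complemented in the Lie algebra of `𝒰_J`, that is, in `𝔲_J`
      (∃ _ : ChartedSpace (isotropyAntihermitian J Q₀) (isotropy J Q₀),
        IsBanachLieSubgroup (jAntihermitian J) (isotropy J Q₀) (isotropyAntihermitian J Q₀) ∧
        (subgroupLieAlgebra (jAntihermitian J) (isotropy J Q₀) (isotropyAntihermitian J Q₀)).map
            (mfderiv 𝓘(ℝ, jAntihermitian J) 𝓘(ℝ, H →L[ℂ] H)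
              (Subtype.val : jUnitary J → (H →L[ℂ] H)ˣ) 1).toLinearMap =
          isotropyAntihermitian J Q₀ ∧
        (subgroupLieAlgebra (jAntihermitian J) (isotropy J Q₀)
          (isotropyAntihermitian J Q₀)).ClosedComplemented ∧
        ((isotropyAntihermitian J Q₀).submoduleOf (jAntihermitian J)).ClosedComplemented) ∧
      -- the orbit, with the quotient topology, is a real-analytic homogeneous space of `𝒰_J`
      (∃ (B : Type u) (_ : NormedAddCommGroup B) (_ : NormedSpace ℝ B)
          (_ : ChartedSpace B (OrbitSpace J Q₀)),
        IsAnalyticHomogeneousSpace (jAntihermitian J) (jUnitary J) B (OrbitSpace J Q₀)) := by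
  have hU := isSliceChart_jUnitary J
  let := hU.chartedSpace
  have hUd : HasMFDerivAt 𝓘(ℝ, jAntihermitian J) 𝓘(ℝ, H →L[ℂ] H)
      (Subtype.val : jUnitary J → (H →L[ℂ] H)ˣ) 1 (jAntihermitian J).subtypeL :=
    hU.hasMFDerivAt_val chartAt_one_comp_cayleyChart_symm
  have hUG := hU.isBanachLieSubgroup
  have := hUG.lieGroup
  have hK := isSliceChart_isotropy Q₀
  let := hK.chartedSpace
  have hKd : HasMFDerivAt 𝓘(ℝ, isotropyAntihermitian J Q₀) 𝓘(ℝ, jAntihermitian J)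
      (Subtype.val : isotropy J Q₀ → jUnitary J) 1 (isotropyInclusion Q₀) :=
    hK.hasMFDerivAt_val hU.chartAt_one_comp_hasFDerivAt
  have hKL : subgroupLieAlgebra (jAntihermitian J) (isotropy J Q₀) (isotropyAntihermitian J Q₀) =
      (isotropyInclusion Q₀).range := by
    rw [subgroupLieAlgebra, hKd.mfderiv]
    rfl
  refine ⟨hU.chartedSpace, hUG, ?_, ⟨hK.chartedSpace, hK.isBanachLieSubgroup, ?_, ?_, ?_⟩, ?_⟩
  · rw [subgroupLieAlgebra, hUd.mfderiv]
    exact Submodule.range_subtype _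
  · rw [hKL, hUd.mfderiv]
    exact map_range_isotropyInclusion Q₀
  · rw [hKL]
    exact closedComplemented_range_isotropyInclusion Q₀
  · rw [← range_isotropyInclusion]
    exact closedComplemented_range_isotropyInclusion Q₀
  -- The model space of the orbit, left implicit below, is the kernel of `isotropyProjection Q₀`, a
  -- complement of `𝔤` in `𝔲_J`.
  · have hS : IsSliceChart (MulAction.stabilizer (jUnitary J) (basePoint Q₀))
        (isotropyInclusion Q₀) (isotropyProjection Q₀) hU.restrict := by
      rw [stabilizer_basePoint]
      exact hK
    obtain ⟨Φ, hΦ⟩ := hS.exists_isAdaptedChart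
    exact ⟨_, inferInstance, inferInstance, hΦ.chartedSpace (isQuotientMap_smul_basePoint Q₀),
      hΦ.isAnalyticHomogeneousSpace (isQuotientMap_smul_basePoint Q₀)⟩
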